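/- Conventions. All objects are holomorphic. Primed spinor components are $\pi_{A'}$, $A'=0',1'$, with $\varepsilon_{01}=\varepsilon^{01}=1$, $\pi^{A'}=\varepsilon^{A'B'}\pi_{B'}$, $u_{B'}=u^{A'}\varepsilon_{A'B'}$ (similarly for unprimed indices), $o^{A'}=(1,0)$, $\iota^{A'}=(0,1)$, $\lambda=\pi_{0'}/\pi_{1'}$. Let $M\subset\mathbb C^4$ be open and let $\nabla_{AA'}$ be four holomorphic vector fields on $M$ with $$[\nabla_{A0'},\nabla_{B0'}]=0,\quad [\nabla_{A0'},\nabla_{B1'}]+[\nabla_{A1'},\nabla_{B0'}]=0,\quad [\nabla_{A1'},\nabla_{B1'}]=0,$$ preserving a holomorphic volume form $\nu$ with $\nu(\nabla_{00'},\nabla_{01'},\nabla_{10'},\nabla_{11'})=1$ (a normalised null tetrad of an anti-self-dual vacuum metric $g$). Let $\mathcal W_g$ be the space of holomorphic solutions on $M$ of $\square_g\phi:=\nabla_{A1'}\nabla^{A}{}_{0'}\phi=0$. For $\phi,\psi\in\mathcal W_g$ write $\psi=R\phi$ if $\iota^{A'}\nabla_{AA'}\phi=o^{A'}\nabla_{AA'}\psi$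 for $A=0,1$; this recursion operator $R$ is many-valued, since $\nabla_{A0'}$ has a kernel. Let $0<\varepsilon<1$, $U=\{|\lambda|<1+\varepsilon\}$, $\tilde U=\{|\lambda|>1-\varepsilon\}\cup\{\lambda=\infty\}$. An $\mathcal O(n)$-valued twistor function on $U$, $\tilde U$ or $U\cap\tilde U$ is a holomorphic function $f(p,\pi_{A'})$ of $p\in M$ and of $\pi_{A'}\ne0$ over this set, homogeneous of degree $n$ in $\pi_{A'}$, with $\pi^{A'}\nabla_{AA'}f=0$. Let $\delta f$ be an $\mathcal O(2)$-valued twistor function on $U\cap\tilde U$, and let $\Gamma$ be the positively oriented circle $|\lambda|=r$ with $1-\varepsilon<r<1+\varepsilon$. Put $$\delta\Theta[\delta f]=\frac1{2\pi i}\oint_\Gamma\frac{\delta f}{(\rho^{B'}o_{B'})^4}\,\rho_{D'}d\rho^{D'},\qquad \delta\Omega[\delta f]=\frac1{2\pi i}\oint_\Gamma\frac{\delta f}{(\rho_{A'}o^{A'})^2(\rho_{B'}\iota^{B'})^2}\,\rho_{C'}d\rho^{C'} .$$ **Proposition.** 1. These functions on $M$ do not depend on $r$, and $\delta\Theta[\delta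 f]\in\mathcal W_g$. 2. ($R\,\delta f=\lambda^{-1}\delta f$.) The function $\lambda^{-1}\delta f=(\pi_{1'}/\pi_{0'})\,\delta f$ is again an $\mathcal O(2)$-valued twistor function on $U\cap\tilde U$, and $\delta\Theta[\lambda^{-1}\delta f]=R\,\delta\Theta[\delta f]$. Moreover, for any $\mathcal O(2)$-valued twistor function $f'$ on $U\cap\tilde U$, one has $\delta\Theta[f']=R\,\delta\Theta[\delta f]$ if and only if $f'-\lambda^{-1}\delta f=a-\tilde a$ for $\mathcal O(2)$-valued twistor functions $a$ on $U$ and $\tilde a$ on $\tilde U$ such that $a$ vanishes to third order at $\lambda=0$ (that is, $a=(\pi^{A'}o_{A'})^3b$ with $b$ holomorphic over $U$). 3. Suppose that $(w,z,x,y)$ are holomorphic coordinates on $M$ (defined by an injective map) in which $$\nabla_{00'}=\partial_y,\quad \nabla_{10'}=-\partial_x,\quad \nabla_{01'}=\partial_w+\Theta_{yy}\partial_x-\Theta_{xy}\partial_y,\quad \nabla_{11'}=\partial_z-\Theta_{xy}\partial_x+\Theta_{xx}\partial_y,$$ where $\Theta$ solves the second heavenly equation $\Theta_{xw}+\Theta_{yz}+\Theta_{xx}\Theta_{yy}-\Theta_{xy}^2=0$.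 Then $\delta\Theta=\delta\Theta[\delta f]$ solves the linearisation of this equation at $\Theta$. Furthermore, $\delta\Theta$ is the variation of $\Theta$ under the linearised deformation of the twistor space with Hamiltonian $\delta f$, in the following sense. Suppose that $\omega^A$ on $U$ and $\tilde\omega^A$ on $\tilde U$ are $\mathcal O(1)$-valued twistor functions such that, at $\pi_{A'}=(\lambda,1)$, $$\omega^0=w+\lambda y-\lambda^2\Theta_x+O(\lambda^3),\qquad \omega^1=z-\lambda x-\lambda^2\Theta_y+O(\lambda^3),$$ and that on $U\cap\tilde U$ one has $\tilde\omega^A=P^A(\omega^B,\pi_{B'})$ and $\delta f=F(\omega^B,\pi_{B'})$ with $P^A$ and $F$ holomorphic on an open set and $\det(\partial P^A/\partial\omega^B)=1$. Let $Y^0=\partial F/\partial\omega^1$, $Y^1=-\partial F/\partial\omega^0$. Then there are functions $\delta\omega^A$ over $U$ and $\delta\tilde\omega^A$ over $\tilde U$, holomorphic in $(p,\pi_{A'})$ and homogeneous of degree one in $\pi_{A'}$, with $$\delta\tilde\omega^A=\frac{\partial P^A}{\partial\omega^B}\,(\delta\omega^B+Y^B)\ \text{ on } U\cap\tilde U,\qquad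 \delta\omega^A=O(\lambda^2)\ \text{ at }\pi_{A'}=(\lambda,1),$$ and all such functions satisfy $\delta\omega^0=-\lambda^2\,\partial_x\delta\Theta+O(\lambda^3)$ and $\delta\omega^1=-\lambda^2\,\partial_y\delta\Theta+O(\lambda^3)$. 4. $\delta\Omega[\delta f]\in\mathcal W_g$ and $R^2\,\delta\Omega[\delta f]=\delta\Theta[\delta f]$, i.e. there is $\psi\in\mathcal W_g$ with $\psi=R\,\delta\Omega[\delta f]$ and $\delta\Theta[\delta f]=R\psi$. If $(w,z,\tilde w,\tilde z)$ are holomorphic coordinates on $M$ (defined by an injective map) in which $$\nabla_{00'}=\Omega_{w\tilde w}\partial_{\tilde z}-\Omega_{w\tilde z}\partial_{\tilde w},\quad \nabla_{10'}=\Omega_{z\tilde w}\partial_{\tilde z}-\Omega_{z\tilde z}\partial_{\tilde w},\quad \nabla_{01'}=\partial_w,\quad \nabla_{11'}=\partial_z,$$ where $\Omega$ solves the first heavenly equation $\Omega_{w\tilde z}\Omega_{z\tilde w}-\Omega_{w\tilde w}\Omega_{z\tilde z}=1$, then $\delta\Omega[\delta f]$ solves the linearisation of this equation at $\Omega$. 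-/

import Mathlib

open Asymptotics Topology

noncomputable section

namespace Heavenly

/-- Points of complexified space-time, a region of `ℂ⁴`. -/
abbrev Pt := Fin 4 → ℂ

/-- Two-component spinors. A variable `π : Spinor` stands for the components `π_{A'}` with lower
index, unless the contrary is said. -/
abbrev Spinor := Fin 2 → ℂ

/-- Vector fields on (a region of) `ℂ⁴`. -/
abbrev VF := Pt → Pt

/-- A frame of vector fields `∇_{AA'}`, written `T A A'`. -/
abbrev Frame := Fin 2 → Fin 2 → VF

/-! ### Spinor algebra: `ε_{01} = ε^{01} = 1` -/

/-- `π^{A} = ε^{AB} π_B`. -/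
def up (π : Spinor) : Spinor := ![π 1, -π 0]

/-- `u_{B} = u^A ε_{AB}`. -/
def low (u : Spinor) : Spinor := ![-u 1, u 0]

/-- `o^{A'} = (1, 0)`. -/
def oUp : Spinor := ![1, 0]

/-- `ι^{A'} = (0, 1)`. -/
def iotaUp : Spinor := ![0, 1]

/-- `π^{A'} χ_{A'}` for the spinors with lower components `π_{A'}`, `χ_{A'}`. -/
def pair (π χ : Spinor) : ℂ := ∑ A, up π A * χ A

/-! ### Derivatives -/

/-- The derivative `V(φ)` of the function `φ` along the vector field `V`. -/
def along (V : VF) (φ : Pt → ℂ) : Pt → ℂ := fun p => fderiv ℂ φ p (V p)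

/-- The `i`-th coordinate partial derivative. -/
def pd (i : Fin 4) (φ : Pt → ℂ) : Pt → ℂ := fun p => fderiv ℂ φ p (Pi.single i 1)

/-! ### Anti-self-dual vacuum tetrads, the wave equation, the recursion operator -/

/-- `T A A' = ∇_{AA'}` is a normalised null tetrad of an ASD vacuum metric on `M`, in covariantly
constant primed spin frame: the `∇_{AA'}` satisfy the field equations
`[∇_{A0'}, ∇_{B0'}] = 0`, `[∇_{A0'}, ∇_{B1'}] + [∇_{A1'}, ∇_{B0'}] = 0`, `[∇_{A1'}, ∇_{B1'}] = 0`
and preserve a holomorphic volume form `ν d⁴x` with `ν(∇_{00'}, ∇_{01'}, ∇_{10'}, ∇_{11'}) = 1`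
(in particular they are linearly independent at every point). -/
structure IsASDVacuumTetrad (M : Set Pt) (T : Frame) : Prop where
  holomorphic : ∀ A A', DifferentiableOn ℂ (T A A') M
  eq_zero_zero : ∀ A B, ∀ p ∈ M, VectorField.lieBracket ℂ (T A 0) (T B 0) p = 0
  eq_zero_one : ∀ A B, ∀ p ∈ M, VectorField.lieBracket ℂ (T A 0) (T B 1) p
    + VectorField.lieBracket ℂ (T A 1) (T B 0) p = 0
  eq_one_one : ∀ A B, ∀ p ∈ M, VectorField.lieBracket ℂ (T A 1) (T B 1) p = 0
  volume : ∃ ν : Pt → ℂ, DifferentiableOn ℂ ν M ∧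
    (∀ p ∈ M, ν p * (Matrix.of ![T 0 0 p, T 0 1 p, T 1 0 p, T 1 1 p]).det = 1) ∧
    ∀ A A', ∀ p ∈ M, ∑ i, pd i (fun q => ν q * T A A' q i) p = 0

/-- The wave operator `□_g φ = ∇_{A1'} ∇^A_{0'} φ`, where `∇^A_{0'} = ε^{AB} ∇_{B0'}`. -/
def box (T : Frame) (φ : Pt → ℂ) (p : Pt) : ℂ :=
  ∑ A, along (T A 1) (fun q => up (fun B => along (T B 0) φ q) A) p

/-- The space `W_g` of holomorphic solutions on `M` of the wave equation. -/
def WaveSolution (M : Set Pt) (T : Frame) (φ : Pt → ℂ) : Prop :=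
  DifferentiableOn ℂ φ M ∧ ∀ p ∈ M, box T φ p = 0

/-- `ψ = R φ` for the recursion operator `R` on `W_g`, that is
`ι^{A'} ∇_{AA'} φ = o^{A'} ∇_{AA'} ψ`. As `∇_{A0'}` can only be inverted up to boundary conditions,
`R` is a relation. -/
def IsRecursion (M : Set Pt) (T : Frame) (φ ψ : Pt → ℂ) : Prop :=
  WaveSolution M T φ ∧ WaveSolution M T ψ ∧ ∀ A, ∀ p ∈ M,
    ∑ A', iotaUp A' * along (T A A') φ p = ∑ A', oUp A' * along (T A A') ψ p

/-! ### Twistor functions -/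

/-- `U`: `|λ| < 1 + ε`, where `λ = π_{0'} / π_{1'}`. -/
def patchU (ε : ℝ) : Set Spinor := {π | ‖π 0‖ < (1 + ε) * ‖π 1‖}

/-- `Ũ`: `|λ| > 1 - ε`, including `λ = ∞`. -/
def patchU' (ε : ℝ) : Set Spinor := {π | (1 - ε) * ‖π 1‖ < ‖π 0‖}

/-- A holomorphic function on the part of the primed spin bundle of `M` over `C`, homogeneous of
degree `n` in `π_{A'}`. -/
def IsSection (M : Set Pt) (C : Set Spinor) (n : ℕ) (f : Pt × Spinor → ℂ) : Prop :=
  DifferentiableOn ℂ f (M ×ˢ C) ∧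
    ∀ p ∈ M, ∀ π ∈ C, ∀ t : ℂ, t ≠ 0 → f (p, t • π) = t ^ n * f (p, π)

/-- A twistor function with values in `O(n)`, pulled back to the primed spin bundle: it is constant
along the twistor distribution, `π^{A'} ∇_{AA'} f = 0`. -/
def IsTwistorFunction (M : Set Pt) (T : Frame) (C : Set Spinor) (n : ℕ)
    (f : Pt × Spinor → ℂ) : Prop :=
  IsSection M C n f ∧ ∀ A, ∀ p ∈ M, ∀ π ∈ C,
    ∑ A', up π A' * along (T A A') (fun q => f (q, π)) p = 0

/-- Multiplication by `λ⁻¹ = π_{1'} / π_{0'}`. -/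
def lambdaInv (f : Pt × Spinor → ℂ) : Pt × Spinor → ℂ := fun q => q.2 1 / q.2 0 * f q

/-- `f₁` and `f₂` represent the same class in `H¹(PT, O(2))` for the covering `U, Ũ`, and their
difference is the coboundary of twistor functions `a` on `U`, `a'` on `Ũ` for which `a` vanishes to
third order at `π_{A'} = o_{A'}` (so that the Plebański gauge is preserved). -/
def Cohomologous (M : Set Pt) (T : Frame) (ε : ℝ) (f₁ f₂ : Pt × Spinor → ℂ) : Prop :=
  ∃ a a' b : Pt × Spinor → ℂ,
    IsTwistorFunction M T (patchU ε) 2 a ∧ IsTwistorFunction M T (patchU' ε) 2 a' ∧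
    DifferentiableOn ℂ b (M ×ˢ patchU ε) ∧
    (∀ p ∈ M, ∀ π ∈ patchU ε, a (p, π) = pair π (low oUp) ^ 3 * b (p, π)) ∧
    ∀ p ∈ M, ∀ π ∈ patchU ε ∩ patchU' ε, f₁ (p, π) - f₂ (p, π) = a (p, π) - a' (p, π)

/-! ### Contour integrals -/

/-- The positively oriented circle `|λ| = r`. -/
def circle (r : ℝ) (θ : ℝ) : Spinor := ![r * Complex.exp (θ * Complex.I), 1]

/-- `(2πi)⁻¹ ∮ g(ρ) ρ_{D'} dρ^{D'}` over the circle `|λ| = r`. -/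
def contour (r : ℝ) (g : Spinor → ℂ) : ℂ :=
  (2 * Real.pi * Complex.I)⁻¹ * ∫ θ in (0 : ℝ)..(2 * Real.pi),
    g (circle r θ) * ∑ D, circle r θ D * deriv (fun t => up (circle r t) D) θ

/-- `δΘ = (2πi)⁻¹ ∮ δf / (ρ^{B'} o_{B'})⁴ ρ_{D'} dρ^{D'}`. -/
def deltaTheta (r : ℝ) (f : Pt × Spinor → ℂ) (p : Pt) : ℂ :=
  contour r fun ρ => f (p, ρ) / pair ρ (low oUp) ^ 4

/-- `δΩ = (2πi)⁻¹ ∮ δf / ((ρ_{A'} o^{A'})² (ρ_{B'} ι^{B'})²) ρ_{C'} dρ^{C'}`. -/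
def deltaOmega (r : ℝ) (f : Pt × Spinor → ℂ) (p : Pt) : ℂ :=
  contour r fun ρ => f (p, ρ) / ((∑ A, ρ A * oUp A) ^ 2 * (∑ B, ρ B * iotaUp B) ^ 2)

/-! ### The second heavenly form: coordinates `(w, z, x, y)` -/

/-- `∇_{00'} = ∂_y`, `∇_{10'} = -∂_x`, `∇_{01'} = ∂_w + Θ_yy ∂_x - Θ_xy ∂_y`,
`∇_{11'} = ∂_z - Θ_xy ∂_x + Θ_xx ∂_y`. -/
def secondFrame (Θ : Pt → ℂ) : Frame :=
  ![![fun _ => ![0, 0, 0, 1],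
      fun q => ![1, 0, pd 3 (pd 3 Θ) q, -pd 2 (pd 3 Θ) q]],
    ![fun _ => ![0, 0, -1, 0],
      fun q => ![0, 1, -pd 2 (pd 3 Θ) q, pd 2 (pd 2 Θ) q]]]

/-- `Θ_xw + Θ_yz + Θ_xx Θ_yy - Θ_xy²`. -/
def secondHeavenly (Θ : Pt → ℂ) (q : Pt) : ℂ :=
  pd 2 (pd 0 Θ) q + pd 3 (pd 1 Θ) q + pd 2 (pd 2 Θ) q * pd 3 (pd 3 Θ) q - pd 2 (pd 3 Θ) q ^ 2

/-- The linearisation of `secondHeavenly` at `Θ` in the direction `φ`. -/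
def secondLinearised (Θ φ : Pt → ℂ) (q : Pt) : ℂ :=
  pd 2 (pd 0 φ) q + pd 3 (pd 1 φ) q + pd 2 (pd 2 φ) q * pd 3 (pd 3 Θ) q
    + pd 2 (pd 2 Θ) q * pd 3 (pd 3 φ) q - 2 * pd 2 (pd 3 Θ) q * pd 2 (pd 3 φ) q

/-- `c = (w, z, x, y)` are holomorphic coordinates on `M` in which the tetrad has the second
Plebański form with potential `Θ`, and `Θ` solves the second heavenly equation. -/
structure IsSecondForm (M : Set Pt) (T : Frame) (c : Pt → Pt) (Θ : Pt → ℂ) : Prop where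
  holomorphic : DifferentiableOn ℂ c M
  injective : Set.InjOn c M
  potential : DifferentiableOn ℂ Θ (c '' M)
  heavenly : ∀ q ∈ c '' M, secondHeavenly Θ q = 0
  frame : ∀ A A', ∀ p ∈ M, fderiv ℂ c p (T A A' p) = secondFrame Θ A A' (c p)

/-! ### The first heavenly form: coordinates `(w, z, w̃, z̃)` -/

/-- `∇_{00'} = Ω_ww̃ ∂_z̃ - Ω_wz̃ ∂_w̃`, `∇_{10'} = Ω_zw̃ ∂_z̃ - Ω_zz̃ ∂_w̃`,
`∇_{01'} = ∂_w`, `∇_{11'} = ∂_z`. -/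
def firstFrame (Ω : Pt → ℂ) : Frame :=
  ![![fun q => ![0, 0, -pd 0 (pd 3 Ω) q, pd 0 (pd 2 Ω) q],
      fun _ => ![1, 0, 0, 0]],
    ![fun q => ![0, 0, -pd 1 (pd 3 Ω) q, pd 1 (pd 2 Ω) q],
      fun _ => ![0, 1, 0, 0]]]

/-- `Ω_wz̃ Ω_zw̃ - Ω_ww̃ Ω_zz̃`. -/
def firstHeavenly (Ω : Pt → ℂ) (q : Pt) : ℂ :=
  pd 0 (pd 3 Ω) q * pd 1 (pd 2 Ω) q - pd 0 (pd 2 Ω) q * pd 1 (pd 3 Ω) q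

/-- The linearisation of `firstHeavenly` at `Ω` in the direction `φ`. -/
def firstLinearised (Ω φ : Pt → ℂ) (q : Pt) : ℂ :=
  pd 0 (pd 3 φ) q * pd 1 (pd 2 Ω) q + pd 0 (pd 3 Ω) q * pd 1 (pd 2 φ) q
    - pd 0 (pd 2 φ) q * pd 1 (pd 3 Ω) q - pd 0 (pd 2 Ω) q * pd 1 (pd 3 φ) q

/-- `c = (w, z, w̃, z̃)` are holomorphic coordinates on `M` in which the tetrad has the first
Plebański form with potential `Ω`, and `Ω` solves the first heavenly equation. -/
structure IsFirstForm (M : Set Pt) (T : Frame) (c : Pt → Pt) (Ω : Pt → ℂ) : Prop where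
  holomorphic : DifferentiableOn ℂ c M
  injective : Set.InjOn c M
  potential : DifferentiableOn ℂ Ω (c '' M)
  heavenly : ∀ q ∈ c '' M, firstHeavenly Ω q = 1
  frame : ∀ A A', ∀ p ∈ M, fderiv ℂ c p (T A A' p) = firstFrame Ω A A' (c p)

/-! ### Twistor coordinates and linearised deformations of the twistor space -/

/-- `∂g/∂ω^B` for a function `g` of `(ω^A, π_{A'})`. -/
def pdOmega (B : Fin 2) (g : Spinor × Spinor → ℂ) (Z : Spinor × Spinor) : ℂ :=
  fderiv ℂ g Z (Pi.single B 1, 0)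

/-- The point of non-projective twistor space, in the coordinates `(ω^A, π_{A'})`, that lies over
the point `(p, π)` of the spin bundle. -/
def twistorPt (ω : Fin 2 → Pt × Spinor → ℂ) (p : Pt) (π : Spinor) : Spinor × Spinor :=
  (fun A => ω A (p, π), π)

/-- The `λ²` coefficients `(-Θ_x, -Θ_y)` of the twistor coordinates. -/
def jetTwo (Θ : Pt → ℂ) (q : Pt) : Fin 2 → ℂ := ![-pd 2 Θ q, -pd 3 Θ q]

/-- The twistor space of `M` in coordinates: `ω^A` on `U` and `ω̃^A` on `Ũ` (written `ω'`) are
twistor functions of degree one, with the normalisation at `λ = 0`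
`ω⁰ = w + λ y - λ² Θ_x + O(λ³)`, `ω¹ = z - λ x - λ² Θ_y + O(λ³)`
belonging to the second Plebański form `(c, Θ)`, and
`ω̃^A = P^A(ω^B, π_{B'})` on the overlap, with a transition function `P` that is holomorphic on the
open set `W` and preserves the fibrewise symplectic form. -/
structure IsTwistorPatching (M : Set Pt) (T : Frame) (ε : ℝ) (c : Pt → Pt) (Θ : Pt → ℂ)
    (W : Set (Spinor × Spinor)) (P : Fin 2 → Spinor × Spinor → ℂ)
    (ω ω' : Fin 2 → Pt × Spinor → ℂ) : Prop where
  coord : ∀ A, IsTwistorFunction M T (patchU ε) 1 (ω A)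
  coord' : ∀ A, IsTwistorFunction M T (patchU' ε) 1 (ω' A)
  jet : ∀ A, ∀ p ∈ M, (fun l : ℂ => ω A (p, ![l, 1])
    - ((![c p 0, c p 1] : Fin 2 → ℂ) A + l * (![c p 3, -c p 2] : Fin 2 → ℂ) A
      + l ^ 2 * jetTwo Θ (c p) A)) =O[𝓝 0] fun l : ℂ => l ^ 3
  isOpen : IsOpen W
  mem : ∀ p ∈ M, ∀ π ∈ patchU ε ∩ patchU' ε, twistorPt ω p π ∈ W
  transition_holomorphic : ∀ A, DifferentiableOn ℂ (P A) W
  transition : ∀ A, ∀ p ∈ M, ∀ π ∈ patchU ε ∩ patchU' ε,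
    ω' A (p, π) = P A (twistorPt ω p π)
  symplectic : ∀ Z ∈ W, (Matrix.of fun A B => pdOmega B (P A) Z).det = 1

/-- The Hamiltonian vector field `Y^A = ε^{AB} ∂F/∂ω^B`. -/
def hamVF (F : Spinor × Spinor → ℂ) (Z : Spinor × Spinor) : Fin 2 → ℂ :=
  ![pdOmega 1 F Z, -pdOmega 0 F Z]

/-- First order variation `(δω^A, δω̃^A)` of the twistor lines under the linearised deformation of
the twistor space with Hamiltonian `F`. The deformation of the transition function is `Y(P^A)` with
`Y` the Hamiltonian vector field of `F`, so
`δω̃^A = ∂P^A/∂ω^B (δω^B + Y^B)` on the overlap. The labelling `(w, z, x, y)` of the lines is fixed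
by `δω^A = O(λ²)`. -/
structure IsLineVariation (M : Set Pt) (ε : ℝ) (P : Fin 2 → Spinor × Spinor → ℂ)
    (ω : Fin 2 → Pt × Spinor → ℂ) (F : Spinor × Spinor → ℂ)
    (dω dω' : Fin 2 → Pt × Spinor → ℂ) : Prop where
  section_U : ∀ A, IsSection M (patchU ε) 1 (dω A)
  section_U' : ∀ A, IsSection M (patchU' ε) 1 (dω' A)
  overlap : ∀ A, ∀ p ∈ M, ∀ π ∈ patchU ε ∩ patchU' ε,
    dω' A (p, π) = ∑ B, pdOmega B (P A) (twistorPt ω p π)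
      * (dω B (p, π) + hamVF F (twistorPt ω p π) B)
  gauge : ∀ A, ∀ p ∈ M, (fun l : ℂ => dω A (p, ![l, 1])) =O[𝓝 0] fun l : ℂ => l ^ 2

end Heavenly

end

/-!
Write `λ = π_{0'} / π_{1'}` and expand a twistor function over `U ∩ Ũ` in a Laurent series
`f(p, (λ, 1)) = ∑ f_k(p) λ^k`. The twistor equation says `∇_{A0'} f_{k+1} = ∇_{A1'} f_k`
(`along_moment_succ`), so that `f_{k+1}` is obtained from `f_k` by the recursion operator, and
`□ f_k = [∇_{01'}, ∇_{11'}] f_{k-1} = 0`. Up to sign, `δΩ` and `δΘ` are the coefficients `f_1` and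
`f_3`, and multiplication by `λ⁻¹` shifts the coefficients by one; this gives the statements on
`R`. The coefficients are contour integrals (`moment`), and are differentiated under the integral
sign; this, and the symmetry of second derivatives, rest on Cauchy's estimates for holomorphic
functions of several variables (`hasFDerivAt_circleIntegral`, `contDiffOn_of_differentiableOn`).

The equation `δΘ[f'] = R δΘ[δf]` says that `h = f' - λ⁻¹ δf` has `∇_{A0'} h_3 = 0`. A section `h` of
degree two over the overlap is always the difference of the part `a` of its Laurent series with
powers at least three, which extends to `U`, and of a section `a'` over `Ũ` (`exists_splitting`).
Both parts are Cauchy integrals, and the twistor equation fails for them by the multiple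
`∇_{A0'} h_3` of `π_{0'}³` (`twistor_defect_cauchyKernel`). Hence the cohomological freedom is
exactly the condition `∇_{A0'} h_3 = 0` (`cohomologous_iff`).

In a Plebański form the tetrad spans the tangent space, so the coordinate map is a local
biholomorphism and the wave operator can be computed in the coordinates, where it is the linearised
heavenly equation (`box_secondFrame`, `box_firstFrame`).

Finally let `δω`, `δω̃` vary the twistor lines, and let `⟨u, v⟩ = u⁰ v¹ - u¹ v⁰` (`wedge`). Since the
transition function preserves the symplectic form,
`⟨δω̃, ∇_{A1'} ω̃⟩ = ⟨δω, ∇_{A1'} ω⟩ + ∇_{A1'} δf` on the overlap. The left side has no powers of `λ`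
above the first, and the first term on the right none below the second; comparing coefficients of
`λ²` yields the second order part of `δω` in terms of `∇_{A1'} f_2 = ∇_{A0'} f_3`
(`jet_of_isLineVariation`). Conversely, splitting the sections `∇_{A0'} δf` as above determines the
pairings of `δω` and `δω̃` with `∇_{A0'} ω` and `∇_{A0'} ω̃`. These can be solved for `δω` and `δω̃`
because `⟨∇_{01'} ω, ∇_{11'} ω⟩ = π_{1'}²`, by Liouville's theorem on the Riemann sphere
(`wedge_alongC`, `exists_isLineVariation`).
-/

noncomputable section

namespace Heavenly

open Metric Set

/-! ### Holomorphic functions of several variables -/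

section SeveralVariables

variable {E F : Type*} [NormedAddCommGroup E] [NormedSpace ℂ E]
  [NormedAddCommGroup F] [NormedSpace ℂ F]

/-- Cauchy's estimate for the Fréchet derivative. -/
theorem norm_fderiv_le_of_norm_le {g : E → F} {x : E} {δ C : ℝ} (hδ : 0 < δ)
    (hg : DifferentiableOn ℂ g (ball x δ)) (hC : ∀ y ∈ ball x δ, ‖g y‖ ≤ C) :
    ‖fderiv ℂ g x‖ ≤ 2 * C / δ := by
  refine Complex.norm_fderiv_le_div_of_mapsTo_ball hg (fun y hy => ?_) hδ
  rw [mem_closedBall, dist_eq_norm]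
  have h1 := hC y hy
  have h2 := hC x (mem_ball_self hδ)
  linarith [norm_sub_le (g y) (g x)]

/-- The derivative of a holomorphic function depending continuously on a parameter depends
continuously on the parameter. -/
theorem continuousOn_fderiv_param [ProperSpace E] {Z : Type*} [PseudoMetricSpace Z]
    {S : Set E} (hS : IsOpen S) {K : Set Z} (hK : IsCompact K) {G : E → Z → F}
    (hcont : ContinuousOn (Function.uncurry G) (S ×ˢ K))
    (hd : ∀ z ∈ K, DifferentiableOn ℂ (fun y => G y z) S) {x : E} (hx : x ∈ S) :
    ContinuousOn (fun z => fderiv ℂ (fun y => G y z) x) K := by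
  obtain ⟨δ, hδ, hδS⟩ := nhds_basis_closedBall.mem_iff.1 (hS.mem_nhds hx)
  have hsub : closedBall x δ ×ˢ K ⊆ S ×ˢ K := prod_mono hδS Subset.rfl
  have huc := ((isCompact_closedBall x δ).prod hK).uniformContinuousOn_of_continuous
    (hcont.mono hsub)
  rw [Metric.uniformContinuousOn_iff] at huc
  rw [Metric.continuousOn_iff]
  intro z hz η hη
  obtain ⟨κ, hκ, hu⟩ := huc (η * δ / 4) (by positivity)
  refine ⟨κ, hκ, fun w hw hwz => ?_⟩
  have hdw : DifferentiableAt ℂ (fun y => G y w) x := (hd w hw).differentiableAt (hS.mem_nhds hx)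
  have hdz : DifferentiableAt ℂ (fun y => G y z) x := (hd z hz).differentiableAt (hS.mem_nhds hx)
  rw [dist_eq_norm, ← fderiv_fun_sub hdw hdz]
  have hb : ball x δ ⊆ S := ball_subset_closedBall.trans hδS
  refine (norm_fderiv_le_of_norm_le (C := η * δ / 4) hδ
    (((hd w hw).sub (hd z hz)).mono hb) fun y hy => ?_).trans_lt ?_
  · have := hu (y, w) ⟨ball_subset_closedBall hy, hw⟩ (y, z) ⟨ball_subset_closedBall hy, hz⟩
      (by simpa [Prod.dist_eq, hκ] using hwz)
    rw [dist_eq_norm] at this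
    exact this.le
  · rw [div_lt_iff₀ hδ]
    nlinarith

/-- Differentiation under the integral sign: a contour integral of a function which is holomorphic
in `y` and continuous in `(y, z)` is holomorphic in `y`. -/
theorem hasFDerivAt_circleIntegral [ProperSpace E] {S : Set E} (hS : IsOpen S)
    {G : E → ℂ → F} {c : ℂ} {R : ℝ} (hR : 0 ≤ R)
    (hcont : ContinuousOn (Function.uncurry G) (S ×ˢ sphere c R))
    (hd : ∀ z ∈ sphere c R, DifferentiableOn ℂ (fun y => G y z) S) {x : E} (hx : x ∈ S) :
    HasFDerivAt (fun y => ∮ z in C(c, R), G y z)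
      (∮ z in C(c, R), fderiv ℂ (fun y => G y z) x) x := by
  have hsph : IsCompact (sphere c R) := isCompact_sphere c R
  have hmem : ∀ θ, circleMap c R θ ∈ sphere c R := fun θ => circleMap_mem_sphere c hR θ
  obtain ⟨δ, hδ, hδS⟩ := nhds_basis_closedBall.mem_iff.1 (hS.mem_nhds hx)
  obtain ⟨C, hC⟩ := ((isCompact_closedBall x δ).prod hsph).exists_bound_of_continuousOn
    (hcont.mono (prod_mono hδS Subset.rfl))
  have hslice : ∀ y ∈ S, ContinuousOn (G y) (sphere c R) := fun y hy =>
    hcont.comp (f := fun z => (y, z)) (by fun_prop) fun z hz => ⟨hy, hz⟩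
  have hcm : Continuous (deriv (circleMap c R)) := by
    have : deriv (circleMap c R) = fun θ => circleMap 0 R θ * Complex.I := by
      ext θ; exact deriv_circleMap c R θ
    rw [this]; fun_prop
  have hint : ∀ y ∈ S, Continuous fun θ => deriv (circleMap c R) θ • G y (circleMap c R θ) :=
    fun y hy => hcm.smul ((hslice y hy).comp_continuous (continuous_circleMap c R) hmem)
  have hfd : Continuous fun θ => deriv (circleMap c R) θ •
      fderiv ℂ (fun y => G y (circleMap c R θ)) x :=
    hcm.smul ((continuousOn_fderiv_param hS hsph hcont hd hx).comp_continuous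
      (continuous_circleMap c R) hmem)
  unfold circleIntegral
  refine intervalIntegral.hasFDerivAt_integral_of_dominated_of_fderiv_le
    (F' := fun y θ => deriv (circleMap c R) θ • fderiv ℂ (fun y => G y (circleMap c R θ)) y)
    (s := ball x (δ / 2)) (bound := fun _ => |R| * (2 * C / (δ / 2)))
    (ball_mem_nhds x (by positivity)) ?_ ((hint x hx).intervalIntegrable _ _)
    hfd.aestronglyMeasurable ?_ intervalIntegrable_const ?_
  · filter_upwards [hS.mem_nhds hx] with y hy using (hint y hy).aestronglyMeasurable
  · refine Filter.Eventually.of_forall fun θ _ y hy => ?_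
    have hsub : ball y (δ / 2) ⊆ closedBall x δ := by
      intro u hu
      rw [mem_ball] at hu hy
      rw [mem_closedBall]
      linarith [dist_triangle u y x]
    rw [norm_smul]
    refine mul_le_mul (by simp) (norm_fderiv_le_of_norm_le (by positivity)
      ((hd _ (hmem θ)).mono (hsub.trans hδS)) fun u hu => hC (u, _) ⟨hsub hu, hmem θ⟩)
      (norm_nonneg _) (abs_nonneg _)
  · refine Filter.Eventually.of_forall fun θ _ y hy => ?_
    have hyS : y ∈ S := hδS (ball_subset_closedBall (ball_subset_ball (by linarith) hy))
    exact (((hd _ (hmem θ)).differentiableAt (hS.mem_nhds hyS)).hasFDerivAt).const_smul _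

/-- Derivatives of holomorphic functions of several variables are holomorphic. -/
theorem differentiableOn_fderiv_apply [ProperSpace E] [CompleteSpace F] {S : Set E}
    (hS : IsOpen S) {f : E → F} (hf : DifferentiableOn ℂ f S) (v : E) :
    DifferentiableOn ℂ (fun x => fderiv ℂ f x v) S := by
  intro x hx
  obtain ⟨δ, hδ, hδS⟩ := nhds_basis_closedBall.mem_iff.1 (hS.mem_nhds hx)
  -- The circle `|z| = ρ` is so small that `y + z v` stays in the domain for `y` close to `x`.
  obtain ⟨ρ, hρ, hρv⟩ : ∃ ρ : ℝ, 0 < ρ ∧ ρ * ‖v‖ < δ / 2 := by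
    refine ⟨δ / 2 / (‖v‖ + 1), by positivity, ?_⟩
    rw [div_mul_eq_mul_div, div_lt_iff₀ (by positivity)]
    nlinarith [norm_nonneg v]
  have hmem : ∀ y ∈ ball x (δ / 2), ∀ z ∈ closedBall (0 : ℂ) ρ, y + z • v ∈ S := by
    intro y hy z hz
    apply hδS
    rw [mem_closedBall, dist_eq_norm]
    rw [mem_ball, dist_eq_norm] at hy
    rw [mem_closedBall, dist_zero_right] at hz
    have : ‖z • v‖ ≤ ρ * ‖v‖ := by rw [norm_smul]; gcongr
    calc ‖y + z • v - x‖ = ‖(y - x) + z • v‖ := by congr 1; abel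
      _ ≤ ‖y - x‖ + ‖z • v‖ := norm_add_le _ _
      _ ≤ δ := by linarith
  have hz0 : ∀ z ∈ sphere (0 : ℂ) ρ, z ≠ 0 := fun z hz => ne_of_mem_sphere hz hρ.ne'
  have key : ∀ y ∈ ball x (δ / 2), fderiv ℂ f y v
      = (2 * Real.pi * Complex.I)⁻¹ • ∮ z in C(0, ρ), (z ^ 2)⁻¹ • f (y + z • v) := by
    intro y hy
    have hd : DiffContOnCl ℂ (fun z : ℂ => f (y + z • v)) (ball 0 ρ) := by
      apply DifferentiableOn.diffContOnCl
      rw [closure_ball _ hρ.ne']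
      exact hf.comp (by fun_prop) fun z hz => hmem y hy z hz
    have h1 := hd.deriv_eq_smul_circleIntegral hρ
    have h2 : HasDerivAt (fun z : ℂ => f (y + z • v)) (fderiv ℂ f y v) 0 := by
      have hy' : y + (0 : ℂ) • v ∈ S := hmem y hy 0 (by simp [hρ.le])
      have hfd := (hf.differentiableAt (hS.mem_nhds hy')).hasFDerivAt
      have hl : HasDerivAt (fun z : ℂ => y + z • v) v 0 := by
        simpa using ((hasDerivAt_id (0 : ℂ)).smul_const v).const_add y
      simpa [Function.comp_def] using hfd.comp_hasDerivAt (0 : ℂ) hl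
    rw [h2.deriv] at h1
    rw [eq_inv_smul_iff₀ (by simp [Real.pi_ne_zero]), ← h1]
    simp
  have hopen : ball x (δ / 2) ∈ 𝓝 x := ball_mem_nhds x (by positivity)
  refine DifferentiableAt.differentiableWithinAt ?_
  refine DifferentiableAt.congr_of_eventuallyEq ?_ (Filter.eventuallyEq_of_mem hopen key)
  refine DifferentiableAt.const_smul ?_ _
  refine (hasFDerivAt_circleIntegral (isOpen_ball (x := x) (ε := δ / 2)) hρ.le ?_ ?_
    (mem_ball_self (by positivity)) :
    HasFDerivAt (fun y => ∮ z in C(0, ρ), (z ^ 2)⁻¹ • f (y + z • v)) _ x).differentiableAt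
  · refine ContinuousOn.smul (ContinuousOn.inv₀ (by fun_prop) ?_) ?_
    · rintro ⟨y, z⟩ ⟨_, hz⟩
      exact pow_ne_zero 2 (hz0 z hz)
    · exact hf.continuousOn.comp (f := fun q : E × ℂ => q.1 + q.2 • v) (by fun_prop)
        fun q hq => hmem q.1 hq.1 q.2 (sphere_subset_closedBall hq.2)
  · intro z hz
    exact (hf.comp (f := fun y => y + z • v) (by fun_prop)
      fun y hy => hmem y hy z (sphere_subset_closedBall hz)).fun_const_smul (z ^ 2)⁻¹

/-- Holomorphic functions of several variables are smooth. -/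
theorem contDiffOn_of_differentiableOn [FiniteDimensional ℂ E] [CompleteSpace F] {S : Set E}
    (hS : IsOpen S) {f : E → F} (hf : DifferentiableOn ℂ f S) (n : ℕ) : ContDiffOn ℂ n f S := by
  have : ProperSpace E := FiniteDimensional.proper ℂ E
  induction n generalizing f with
  | zero => simpa [contDiffOn_zero] using hf.continuousOn
  | succ n ih =>
    rw [Nat.cast_succ, contDiffOn_succ_iff_fderiv_apply hS.uniqueDiffOn]
    refine ⟨hf, fun h => absurd h (by simp), fun v => ?_⟩
    refine (ih (differentiableOn_fderiv_apply hS hf v)).congr fun x hx => ?_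
    rw [fderivWithin_of_isOpen hS hx]

theorem differentiableOn_fderiv [FiniteDimensional ℂ E] [CompleteSpace F] {S : Set E}
    (hS : IsOpen S) {f : E → F} (hf : DifferentiableOn ℂ f S) :
    DifferentiableOn ℂ (fderiv ℂ f) S :=
  ((contDiffOn_of_differentiableOn hS hf 2).fderiv_of_isOpen (m := 1) hS
    (by norm_num)).differentiableOn (by norm_num)

end SeveralVariables

/-! ### Contour integrals of functions of one variable -/

/-- The annulus `a < |z| < b`. -/
def annulus (a b : ℝ) : Set ℂ := {z | a < ‖z‖ ∧ ‖z‖ < b}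

theorem isOpen_annulus (a b : ℝ) : IsOpen (annulus a b) :=
  (isOpen_lt continuous_const continuous_norm).inter (isOpen_lt continuous_norm continuous_const)

theorem circleIntegral_eq_of_differentiableAt {s t : ℝ} (hs : 0 < s) (hst : s ≤ t) {g : ℂ → ℂ}
    (hg : ∀ z : ℂ, s ≤ ‖z‖ → ‖z‖ ≤ t → DifferentiableAt ℂ g z) :
    (∮ z in C(0, t), g z) = ∮ z in C(0, s), g z := by
  have hsub : ∀ z ∈ closedBall (0 : ℂ) t \ ball 0 s, DifferentiableAt ℂ g z := by
    intro z hz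
    simp only [mem_sdiff, mem_closedBall, mem_ball, dist_zero_right, not_lt] at hz
    exact hg z hz.2 hz.1
  refine Complex.circleIntegral_eq_of_differentiable_on_annulus_off_countable
    hs hst countable_empty (fun z hz => (hsub z hz).continuousAt.continuousWithinAt)
    fun z hz => hsub z ?_
  exact ⟨ball_subset_closedBall hz.1.1, fun h => hz.1.2 (ball_subset_closedBall h)⟩

theorem circleIntegral_eq_of_annulus {a b : ℝ} (ha : 0 ≤ a) {g : ℂ → ℂ}
    (hg : DifferentiableOn ℂ g (annulus a b)) {s t : ℝ} (hs : s ∈ Ioo a b) (ht : t ∈ Ioo a b) :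
    (∮ z in C(0, s), g z) = ∮ z in C(0, t), g z := by
  wlog hst : s ≤ t generalizing s t
  · exact (this ht hs (le_of_not_ge hst)).symm
  exact (circleIntegral_eq_of_differentiableAt (ha.trans_lt hs.1) hst fun z h1 h2 =>
    hg.differentiableAt ((isOpen_annulus a b).mem_nhds ⟨hs.1.trans_le h1, h2.trans_lt ht.2⟩)).symm

theorem circleIntegral_eq_zero_of_ball {R r : ℝ} (hr : 0 < r) (hrR : r < R) {g : ℂ → ℂ}
    (hg : DifferentiableOn ℂ g (ball 0 R)) : (∮ z in C(0, r), g z) = 0 := by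
  refine DiffContOnCl.circleIntegral_eq_zero hr.le (DifferentiableOn.diffContOnCl (hg.mono ?_))
  rw [closure_ball _ hr.ne']
  exact closedBall_subset_ball hrR

theorem circleIntegral_div_self {R r : ℝ} (hr : 0 < r) (hrR : r < R) {g : ℂ → ℂ}
    (hg : DifferentiableOn ℂ g (ball 0 R)) :
    (∮ z in C(0, r), g z / z) = 2 * Real.pi * Complex.I * g 0 := by
  have h := (hg.mono (closedBall_subset_ball hrR)).circleIntegral_sub_inv_smul
    (mem_ball_self hr)
  simpa [div_eq_inv_mul] using h

/-- The substitution `z ↦ z⁻¹` in a contour integral around the origin. -/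
theorem circleIntegral_inv {r : ℝ} (hr : r ≠ 0) (g : ℂ → ℂ) :
    (∮ z in C(0, r), g z⁻¹ / z ^ 2) = ∮ z in C(0, r⁻¹), g z := by
  have hcm : ∀ θ : ℝ, circleMap 0 r⁻¹ (2 * Real.pi - θ) = (circleMap 0 r θ)⁻¹ := by
    intro θ
    have : Complex.exp ((2 * Real.pi - θ : ℂ) * Complex.I) = (Complex.exp (θ * Complex.I))⁻¹ := by
      rw [← Complex.exp_neg, sub_mul, Complex.exp_sub, Complex.exp_two_pi_mul_I, Complex.exp_neg,
        one_div]
    simp only [circleMap, zero_add]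
    push_cast
    rw [this, mul_inv]
  unfold circleIntegral
  have h := intervalIntegral.integral_comp_sub_left (a := 0) (b := 2 * Real.pi)
    (fun θ => deriv (circleMap 0 r⁻¹) θ • g (circleMap 0 r⁻¹ θ)) (2 * Real.pi)
  rw [sub_self, sub_zero] at h
  rw [← h]
  congr 1
  ext θ
  have hne : circleMap 0 r θ ≠ 0 := by simp [circleMap, hr]
  simp only [deriv_circleMap, hcm, smul_eq_mul]
  field_simp

/-- A contour integral around `∞` of a differential which is regular there. -/
theorem circleIntegral_inv_eq_zero {R r : ℝ} (hr : 0 < r) (hrR : r⁻¹ < R) {g : ℂ → ℂ}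
    (hg : DifferentiableOn ℂ g (ball 0 R)) : (∮ z in C(0, r), g z⁻¹ / z ^ 2) = 0 := by
  rw [circleIntegral_inv hr.ne', circleIntegral_eq_zero_of_ball (inv_pos.2 hr) hrR hg]

theorem circleIntegral_inv_sub_of_lt {r : ℝ} (hr : 0 < r) {l : ℂ} (hl : r < ‖l‖) :
    (∮ z in C(0, r), (z - l)⁻¹) = 0 := by
  refine circleIntegral_eq_zero_of_ball hr hl fun z hz => ?_
  refine (DifferentiableAt.inv (by fun_prop) ?_).differentiableWithinAt
  rintro h
  rw [sub_eq_zero.1 h] at hz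
  simp at hz

/-- Cauchy's integral formula for an annulus. -/
theorem circleIntegral_sub_circleIntegral {a b : ℝ} (ha : 0 ≤ a) {g : ℂ → ℂ}
    (hg : DifferentiableOn ℂ g (annulus a b)) {s t : ℝ} (hs : s ∈ Ioo a b) (ht : t ∈ Ioo a b)
    {l : ℂ} (hsl : s < ‖l‖) (hlt : ‖l‖ < t) :
    (∮ z in C(0, t), g z / (z - l)) - (∮ z in C(0, s), g z / (z - l))
      = 2 * Real.pi * Complex.I * g l := by
  have hl : annulus a b ∈ 𝓝 l :=
    (isOpen_annulus a b).mem_nhds ⟨hs.1.trans hsl, hlt.trans ht.2⟩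
  have hds := (Complex.differentiableOn_dslope hl).2 hg
  have heq := circleIntegral_eq_of_annulus ha hds hs ht
  have hsplit : ∀ u ∈ Ioo a b, u ≠ ‖l‖ → (∮ z in C(0, u), g z / (z - l))
      = (∮ z in C(0, u), dslope g l z) + g l * ∮ z in C(0, u), (z - l)⁻¹ := by
    intro u hu hul
    have hu0 : 0 ≤ u := ha.trans hu.1.le
    have hsub : sphere (0 : ℂ) u ⊆ annulus a b := by
      intro z hz
      rw [mem_sphere_zero_iff_norm] at hz
      rw [← hz] at hu
      exact hu
    have hne : ∀ z ∈ sphere (0 : ℂ) u, z - l ≠ 0 := by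
      intro z hz h
      rw [sub_eq_zero.1 h, mem_sphere_zero_iff_norm] at hz
      exact hul hz.symm
    rw [← circleIntegral.integral_const_mul, ← circleIntegral.integral_add]
    · refine circleIntegral.integral_congr hu0 fun z hz => ?_
      have hzl := hne z hz
      rw [dslope_of_ne _ (sub_ne_zero.1 hzl), slope_def_field]
      field_simp
      ring
    · exact (hds.continuousOn.mono hsub).circleIntegrable hu0
    · refine ContinuousOn.circleIntegrable hu0 ?_
      exact continuousOn_const.mul (ContinuousOn.inv₀ (by fun_prop) hne)
  have hlball : l ∈ ball (0 : ℂ) t := by simpa using hlt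
  rw [hsplit t ht hlt.ne', hsplit s hs hsl.ne, circleIntegral_inv_sub_of_lt (ha.trans_lt hs.1) hsl,
    circleIntegral.integral_sub_inv_of_mem_ball hlball, heq]
  ring

/-- A holomorphic function which is `O(z ^ n)` at the origin is divisible by `z ^ n`. -/
theorem exists_eq_pow_mul_of_isBigO {R : ℝ} (hR : 0 < R) (n : ℕ) {g : ℂ → ℂ}
    (hg : DifferentiableOn ℂ g (ball 0 R)) (hO : g =O[𝓝 0] fun z : ℂ => z ^ n) :
    ∃ h : ℂ → ℂ, DifferentiableOn ℂ h (ball 0 R) ∧ ∀ z, g z = z ^ n * h z := by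
  induction n generalizing g with
  | zero => exact ⟨g, hg, by simp⟩
  | succ n ih =>
    have hnhds : ball (0 : ℂ) R ∈ 𝓝 0 := ball_mem_nhds _ hR
    have hds := (Complex.differentiableOn_dslope hnhds).2 hg
    obtain ⟨C, hC⟩ := hO.bound
    have hg0 : g 0 = 0 := by simpa using hC.self_of_nhds
    have hmul : ∀ z, g z = z * dslope g 0 z := fun z => by
      have := sub_smul_dslope g 0 z
      simpa [hg0] using this.symm
    have hcont : ContinuousAt (dslope g 0) 0 := hds.continuousOn.continuousAt hnhds
    have hbd : ∀ᶠ z in 𝓝[≠] (0 : ℂ), ‖dslope g 0 z‖ ≤ C * ‖z ^ n‖ := by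
      filter_upwards [hC.filter_mono nhdsWithin_le_nhds, self_mem_nhdsWithin] with z hz hz0
      have hz0 : z ≠ 0 := hz0
      rw [hmul z, norm_mul, pow_succ', norm_mul, mul_left_comm] at hz
      exact le_of_mul_le_mul_left hz (norm_pos_iff.2 hz0)
    have hbd0 : ‖dslope g 0 0‖ ≤ C * ‖(0 : ℂ) ^ n‖ := by
      have h1 : Filter.Tendsto (fun z => ‖dslope g 0 z‖) (𝓝[≠] (0 : ℂ)) (𝓝 ‖dslope g 0 0‖) :=
        (hcont.norm).mono_left nhdsWithin_le_nhds
      have h2 : Filter.Tendsto (fun z : ℂ => C * ‖z ^ n‖) (𝓝[≠] (0 : ℂ)) (𝓝 (C * ‖(0 : ℂ) ^ n‖)) :=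
        ((by fun_prop : Continuous fun z : ℂ => C * ‖z ^ n‖).continuousAt).mono_left
          nhdsWithin_le_nhds
      exact le_of_tendsto_of_tendsto h1 h2 hbd
    have hOd : dslope g 0 =O[𝓝 0] fun z : ℂ => z ^ n := by
      refine IsBigO.of_bound C ?_
      rw [eventually_nhdsWithin_iff] at hbd
      filter_upwards [hbd] with z hz
      rcases eq_or_ne z 0 with rfl | h0
      · exact hbd0
      · exact hz h0
    obtain ⟨h, hh, hgh⟩ := ih hds hOd
    exact ⟨h, hh, fun z => by rw [hmul, hgh]; ring⟩

/-- Liouville's theorem on the Riemann sphere: holomorphic functions on two discs around `0` and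
`∞` which agree on the overlap are constant. -/
theorem eq_const_of_glue {R R' : ℝ} (hR : 1 < R) (hR' : 1 < R') {g e : ℂ → ℂ}
    (hg : DifferentiableOn ℂ g (ball 0 R)) (he : DifferentiableOn ℂ e (ball 0 R'))
    (hge : ∀ z ∈ annulus R'⁻¹ R, g z = e z⁻¹) :
    (∀ z ∈ ball (0 : ℂ) R, g z = g 0) ∧ ∀ z ∈ ball (0 : ℂ) R', e z = g 0 := by
  classical
  have hR'0 : 0 < R' := zero_lt_one.trans hR'
  set G : ℂ → ℂ := fun z => if ‖z‖ < R then g z else e z⁻¹ with hG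
  have hG1 : ∀ z, ‖z‖ < R → G z = g z := fun z hz => by simp [hG, hz]
  have hG2 : ∀ z, R'⁻¹ < ‖z‖ → G z = e z⁻¹ := fun z hz => by
    by_cases h : ‖z‖ < R
    · rw [hG1 z h, hge z ⟨hz, h⟩]
    · simp [hG, h]
  have hdiff : Differentiable ℂ G := by
    intro z
    by_cases h : ‖z‖ < R
    · have : ball (0 : ℂ) R ∈ 𝓝 z := isOpen_ball.mem_nhds (by simpa using h)
      exact (hg.differentiableAt this).congr_of_eventuallyEq
        (Filter.eventuallyEq_of_mem this fun y hy => hG1 y (by simpa using hy))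
    · have hz : R'⁻¹ < ‖z‖ := by
        have := inv_lt_one_of_one_lt₀ hR'
        linarith [not_lt.1 h]
      have hz0 : z ≠ 0 := norm_pos_iff.1 ((inv_pos.2 hR'0).trans hz)
      have hopen : {y : ℂ | R'⁻¹ < ‖y‖} ∈ 𝓝 z :=
        (isOpen_lt continuous_const continuous_norm).mem_nhds hz
      have hmem : z⁻¹ ∈ ball (0 : ℂ) R' := by
        simpa using inv_lt_of_inv_lt₀ hR'0 hz
      exact ((he.differentiableAt (isOpen_ball.mem_nhds hmem)).comp z
        (differentiableAt_inv hz0)).congr_of_eventuallyEq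
        (Filter.eventuallyEq_of_mem hopen fun y hy => hG2 y hy)
  obtain ⟨C, hC⟩ := (isCompact_closedBall (0 : ℂ) 1).exists_bound_of_continuousOn
    (hg.continuousOn.mono (closedBall_subset_ball hR))
  obtain ⟨C', hC'⟩ := (isCompact_closedBall (0 : ℂ) 1).exists_bound_of_continuousOn
    (he.continuousOn.mono (closedBall_subset_ball hR'))
  have hbdd : Bornology.IsBounded (range G) := by
    refine isBounded_iff_forall_norm_le.2 ⟨max C C', ?_⟩
    rintro _ ⟨z, rfl⟩
    rcases le_total ‖z‖ 1 with h | h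
    · rw [hG1 z (h.trans_lt hR)]
      exact (hC z (by simpa using h)).trans (le_max_left _ _)
    · rw [hG2 z ((inv_lt_one_of_one_lt₀ hR').trans_le h)]
      exact (hC' _ (by simpa using inv_le_one_of_one_le₀ h)).trans (le_max_right _ _)
  have hconst := fun z => hdiff.apply_eq_apply_of_bounded hbdd z 0
  have hG0 : G 0 = g 0 := hG1 0 (by simpa using zero_lt_one.trans hR)
  have hgc : ∀ z ∈ ball (0 : ℂ) R, g z = g 0 := fun z hz => by
    rw [← hG1 z (by simpa using hz), hconst z, hG0]
  have hec : ∀ z ∈ ball (0 : ℂ) R', z ≠ 0 → e z = g 0 := fun z hz h0 => by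
    have h := hG2 z⁻¹ (by
      rw [norm_inv]
      exact (inv_lt_inv₀ hR'0 (norm_pos_iff.2 h0)).2 (by simpa using hz))
    rw [inv_inv] at h
    rw [← h, hconst, hG0]
  refine ⟨hgc, fun z hz => ?_⟩
  rcases eq_or_ne z 0 with rfl | h0
  · have hcont : Filter.Tendsto e (𝓝[≠] (0 : ℂ)) (𝓝 (e 0)) :=
      (he.continuousOn.continuousAt (isOpen_ball.mem_nhds hz)).tendsto.mono_left
        nhdsWithin_le_nhds
    refine tendsto_nhds_unique hcont (tendsto_const_nhds.congr' ?_)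
    filter_upwards [nhdsWithin_le_nhds (isOpen_ball.mem_nhds hz), self_mem_nhdsWithin] with y hy hy0
    exact (hec y hy hy0).symm
  · exact hec z hz h0

/-! ### The patches of the Riemann sphere -/

theorem isOpen_patchU (ε : ℝ) : IsOpen (patchU ε) := by
  unfold patchU; exact isOpen_lt (by fun_prop) (by fun_prop)

theorem isOpen_patchU' (ε : ℝ) : IsOpen (patchU' ε) := by
  unfold patchU'; exact isOpen_lt (by fun_prop) (by fun_prop)

theorem isOpen_overlap (ε : ℝ) : IsOpen (patchU ε ∩ patchU' ε) :=
  (isOpen_patchU ε).inter (isOpen_patchU' ε)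

theorem affine_mem_patchU {ε : ℝ} {z : ℂ} : ![z, 1] ∈ patchU ε ↔ z ∈ ball (0 : ℂ) (1 + ε) := by
  simp [patchU]

theorem affine_mem_patchU' {ε : ℝ} {z : ℂ} : ![z, 1] ∈ patchU' ε ↔ 1 - ε < ‖z‖ := by
  simp [patchU']

theorem affine_mem_overlap {ε : ℝ} {z : ℂ} :
    ![z, 1] ∈ patchU ε ∩ patchU' ε ↔ z ∈ annulus (1 - ε) (1 + ε) := by
  rw [mem_inter_iff, affine_mem_patchU, affine_mem_patchU', mem_ball_zero_iff, and_comm]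
  rfl

theorem infinity_mem_patchU' {ε : ℝ} (hε : ε < 1) {z : ℂ} :
    ![1, z] ∈ patchU' ε ↔ z ∈ ball (0 : ℂ) (1 - ε)⁻¹ := by
  have h : 0 < 1 - ε := by linarith
  rw [mem_ball_zero_iff, ← one_div, lt_div_iff₀ h]
  simp [patchU', mul_comm]

theorem ne_zero_of_mem_patchU {ε : ℝ} {π : Spinor} (h : π ∈ patchU ε) : π 1 ≠ 0 := by
  intro h1
  have : ‖π 0‖ < (1 + ε) * ‖π 1‖ := h
  rw [h1, norm_zero, mul_zero] at this
  exact (norm_nonneg _).not_gt this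

theorem ne_zero_of_mem_patchU' {ε : ℝ} (hε : ε < 1) {π : Spinor} (h : π ∈ patchU' ε) :
    π 0 ≠ 0 := by
  intro h1
  have : (1 - ε) * ‖π 1‖ < ‖π 0‖ := h
  rw [h1, norm_zero] at this
  exact (mul_nonneg (by linarith) (norm_nonneg _)).not_gt this

theorem sphere_subset_annulus {a b r : ℝ} (hr : r ∈ Ioo a b) : sphere (0 : ℂ) r ⊆ annulus a b := by
  intro z hz
  rw [mem_sphere_zero_iff_norm] at hz
  rw [← hz] at hr
  exact hr

theorem smul_mem_patchU {ε : ℝ} {π : Spinor} {t : ℂ} (ht : t ≠ 0) (h : π ∈ patchU ε) :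
    t • π ∈ patchU ε := by
  have h' : ‖π 0‖ < (1 + ε) * ‖π 1‖ := h
  change ‖(t • π) 0‖ < (1 + ε) * ‖(t • π) 1‖
  simp only [Pi.smul_apply, smul_eq_mul, norm_mul]
  have := mul_lt_mul_of_pos_left h' (norm_pos_iff.2 ht)
  linarith

theorem smul_mem_patchU' {ε : ℝ} {π : Spinor} {t : ℂ} (ht : t ≠ 0) (h : π ∈ patchU' ε) :
    t • π ∈ patchU' ε := by
  have h' : (1 - ε) * ‖π 1‖ < ‖π 0‖ := h
  change (1 - ε) * ‖(t • π) 1‖ < ‖(t • π) 0‖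
  simp only [Pi.smul_apply, smul_eq_mul, norm_mul]
  have := mul_lt_mul_of_pos_left h' (norm_pos_iff.2 ht)
  linarith

theorem pair_low_oUp (π : Spinor) : pair π (low oUp) = -π 0 := by
  simp [pair, up, low, oUp, Fin.sum_univ_two]

section SpinBundle

variable {M : Set Pt} {C : Set Spinor} {f g : Pt × Spinor → ℂ} {n : ℕ}

/-! ### Derivatives of sections along the space-time directions -/

/-- The derivative of a function on the spin bundle along a vector field on space-time, the spinor
being held fixed. -/
def alongS (V : VF) (f : Pt × Spinor → ℂ) : Pt × Spinor → ℂ :=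
  fun q => along V (fun p => f (p, q.2)) q.1

theorem along_congr {M : Set Pt} (hM : IsOpen M) {V : VF} {φ ψ : Pt → ℂ}
    (h : ∀ p ∈ M, φ p = ψ p) {p : Pt} (hp : p ∈ M) : along V φ p = along V ψ p := by
  unfold along
  rw [(Filter.eventuallyEq_of_mem (hM.mem_nhds hp) h).fderiv_eq]

theorem alongS_congr {M : Set Pt} (hM : IsOpen M) {V : VF} {f g : Pt × Spinor → ℂ} {π : Spinor}
    (h : ∀ p ∈ M, f (p, π) = g (p, π)) {p : Pt} (hp : p ∈ M) :
    alongS V f (p, π) = alongS V g (p, π) :=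
  along_congr hM h hp

theorem differentiableOn_along {M : Set Pt} (hM : IsOpen M) {V : VF} (hV : DifferentiableOn ℂ V M)
    {φ : Pt → ℂ} (hφ : DifferentiableOn ℂ φ M) : DifferentiableOn ℂ (along V φ) M :=
  (differentiableOn_fderiv hM hφ).clm_apply hV

theorem hasFDerivAt_slice {p : Pt} {π : Spinor} (hf : DifferentiableAt ℂ f (p, π)) :
    HasFDerivAt (fun q => f (q, π)) ((fderiv ℂ f (p, π)).comp (.inl ℂ Pt Spinor)) p :=
  hf.hasFDerivAt.comp p (hasFDerivAt_prodMk_left p π)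

theorem alongS_eq_fderiv (V : VF) {q : Pt × Spinor} (hf : DifferentiableAt ℂ f q) :
    alongS V f q = fderiv ℂ f q (V q.1, 0) := by
  obtain ⟨p, π⟩ := q
  unfold alongS along
  rw [(hasFDerivAt_slice hf).fderiv]
  rfl

theorem differentiableOn_slice {π : Spinor} (hf : DifferentiableOn ℂ f (M ×ˢ C)) (hπ : π ∈ C) :
    DifferentiableOn ℂ (fun p => f (p, π)) M :=
  hf.comp (f := fun p => (p, π)) (by fun_prop) fun _ hp => ⟨hp, hπ⟩

theorem differentiableOn_alongS (hM : IsOpen M) (hC : IsOpen C) {V : VF}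
    (hV : DifferentiableOn ℂ V M) (hf : DifferentiableOn ℂ f (M ×ˢ C)) :
    DifferentiableOn ℂ (alongS V f) (M ×ˢ C) := by
  have hVC : DifferentiableOn ℂ (fun q : Pt × Spinor => ((V q.1, 0) : Pt × Spinor)) (M ×ˢ C) :=
    (hV.comp differentiableOn_fst fun q hq => hq.1).prodMk (differentiableOn_const _)
  refine ((differentiableOn_fderiv (hM.prod hC) hf).clm_apply hVC).congr fun q hq => ?_
  exact alongS_eq_fderiv V (hf.differentiableAt ((hM.prod hC).mem_nhds hq))

theorem IsSection.alongS (hM : IsOpen M) (hC : IsOpen C) {V : VF} (hV : DifferentiableOn ℂ V M)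
    (hf : IsSection M C n f) : IsSection M C n (alongS V f) := by
  refine ⟨differentiableOn_alongS hM hC hV hf.1, fun p hp π hπ t ht => ?_⟩
  have hd : DifferentiableAt ℂ (fun q => f (q, π)) p :=
    (differentiableOn_slice hf.1 hπ).differentiableAt (hM.mem_nhds hp)
  have : Heavenly.alongS V f (p, t • π) = along V (fun q => t ^ n * f (q, π)) p :=
    along_congr hM (fun q hq => hf.2 q hq π hπ t ht) hp
  rw [this]
  unfold along Heavenly.alongS along
  rw [fderiv_const_mul hd]
  rfl

theorem IsSection.mono {C' : Set Spinor} (hf : IsSection M C n f) (h : C' ⊆ C) :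
    IsSection M C' n f :=
  ⟨hf.1.mono (prod_mono Subset.rfl h), fun p hp π hπ => hf.2 p hp π (h hπ)⟩

/-- A section is determined by its values in the affine coordinate `z = λ`. -/
theorem IsSection.eq_affine (hf : IsSection M C n f) {p : Pt} (hp : p ∈ M) {π : Spinor}
    (h1 : π 1 ≠ 0) (h : ![π 0 / π 1, 1] ∈ C) :
    f (p, π) = π 1 ^ n * f (p, ![π 0 / π 1, 1]) := by
  rw [← hf.2 p hp _ h _ h1]
  congr
  ext i
  fin_cases i
  · simp [mul_div_cancel₀ _ h1]
  · simp

/-- Passage between the affine coordinates `z = λ` and `z⁻¹` around `∞`. -/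
theorem IsSection.eq_infinity (hf : IsSection M C n f) {p : Pt} (hp : p ∈ M) {z : ℂ}
    (hz : z ≠ 0) (h : ![1, z⁻¹] ∈ C) : f (p, ![z, 1]) = z ^ n * f (p, ![1, z⁻¹]) := by
  rw [← hf.2 p hp _ h z hz]
  congr
  ext i
  fin_cases i
  · simp
  · simp [hz]

theorem differentiableOn_affine {D : Set ℂ} (hf : DifferentiableOn ℂ f (M ×ˢ C)) {p : Pt}
    (hp : p ∈ M) (hD : ∀ z ∈ D, ![z, 1] ∈ C) :
    DifferentiableOn ℂ (fun z : ℂ => f (p, ![z, 1])) D := by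
  refine hf.comp (f := fun z : ℂ => ((p, ![z, 1]) : Pt × Spinor)) ?_ fun z hz => ⟨hp, hD z hz⟩
  refine (differentiableOn_const _).prodMk (differentiableOn_pi.2 fun i => ?_)
  fin_cases i
  · exact differentiableOn_id
  · exact differentiableOn_const _

theorem differentiableOn_infinity {D : Set ℂ} (hf : DifferentiableOn ℂ f (M ×ˢ C)) {p : Pt}
    (hp : p ∈ M) (hD : ∀ z ∈ D, ![1, z] ∈ C) :
    DifferentiableOn ℂ (fun z : ℂ => f (p, ![1, z])) D := by
  refine hf.comp (f := fun z : ℂ => ((p, ![1, z]) : Pt × Spinor)) ?_ fun z hz => ⟨hp, hD z hz⟩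
  refine (differentiableOn_const _).prodMk (differentiableOn_pi.2 fun i => ?_)
  fin_cases i
  · exact differentiableOn_const _
  · exact differentiableOn_id

/-! ### Weighted moments of sections over a circle -/

/-- The weighted contour integral `(2πi)⁻¹ ∮ f(p, (z, 1)) w(z) dz` over `|z| = r`. With
`w = z ^ (-k-1)` it is the coefficient of `z ^ k` in the Laurent expansion of `f`. -/
def moment (r : ℝ) (w : ℂ → ℂ) (f : Pt × Spinor → ℂ) (p : Pt) : ℂ :=
  (2 * Real.pi * Complex.I)⁻¹ * ∮ z in C(0, r), f (p, ![z, 1]) * w z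

theorem contour_eq (r : ℝ) (g : Spinor → ℂ) :
    contour r g = -((2 * Real.pi * Complex.I)⁻¹ * ∮ z in C(0, r), g ![z, 1]) := by
  have hc : ∀ θ : ℝ, circle r θ = ![circleMap 0 r θ, 1] := fun θ => by simp [circle, circleMap]
  unfold contour circleIntegral
  rw [← mul_neg, ← intervalIntegral.integral_neg]
  congr 2
  ext θ
  have h0 : (fun t => up (circle r t) 0) = fun _ => (1 : ℂ) := by ext t; simp [up, hc]
  have h1 : (fun t => up (circle r t) 1) = fun t => -circleMap 0 r t := by ext t; simp [up, hc]
  rw [Fin.sum_univ_two, h0, h1, deriv.fun_neg, deriv_const, hc]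
  simp
  ring

theorem deltaTheta_eq (r : ℝ) (f : Pt × Spinor → ℂ) (p : Pt) :
    deltaTheta r f p = -moment r (fun z => (z ^ 4)⁻¹) f p := by
  unfold deltaTheta moment
  rw [contour_eq]
  simp only [pair_low_oUp]
  simp [div_eq_mul_inv, Even.neg_pow (by decide : Even 4)]

theorem deltaOmega_eq (r : ℝ) (f : Pt × Spinor → ℂ) (p : Pt) :
    deltaOmega r f p = -moment r (fun z => (z ^ 2)⁻¹) f p := by
  unfold deltaOmega moment
  rw [contour_eq]
  simp [oUp, iotaUp, Fin.sum_univ_two, div_eq_mul_inv]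

theorem moment_congr {r : ℝ} (hr : 0 ≤ r) {w w' : ℂ → ℂ} {p p' : Pt}
    (h : ∀ z ∈ sphere (0 : ℂ) r, f (p, ![z, 1]) * w z = g (p', ![z, 1]) * w' z) :
    moment r w f p = moment r w' g p' := by
  unfold moment
  rw [circleIntegral.integral_congr hr h]

theorem moment_eq_of_annulus {ε : ℝ} (hε : ε < 1) {w : ℂ → ℂ}
    (hw : DifferentiableOn ℂ w (annulus (1 - ε) (1 + ε)))
    (hf : DifferentiableOn ℂ f (M ×ˢ (patchU ε ∩ patchU' ε))) {p : Pt} (hp : p ∈ M) {r s : ℝ}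
    (hr : r ∈ Ioo (1 - ε) (1 + ε)) (hs : s ∈ Ioo (1 - ε) (1 + ε)) :
    moment r w f p = moment s w f p := by
  unfold moment
  rw [circleIntegral_eq_of_annulus (by linarith) ((differentiableOn_affine hf hp
    fun z hz => affine_mem_overlap.2 hz).fun_mul hw) hr hs]

theorem continuousOn_affine {X : Type*} [NormedAddCommGroup X] [NormedSpace ℂ X]
    {u : X → ℂ} {s : Set X} (hu : ContinuousOn u s) :
    ContinuousOn (fun x => (![u x, 1] : Spinor)) s := by
  refine continuousOn_pi.2 fun i => ?_
  fin_cases i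
  · exact hu
  · exact continuousOn_const

/-- Moments may be differentiated under the integral sign. -/
theorem hasFDerivAt_moment (hM : IsOpen M) {r : ℝ} (hr : 0 ≤ r) {w : ℂ → ℂ}
    (hw : ContinuousOn w (sphere 0 r)) (hf : DifferentiableOn ℂ f (M ×ˢ C))
    (hC : ∀ z ∈ sphere (0 : ℂ) r, ![z, 1] ∈ C) {p : Pt} (hp : p ∈ M) :
    DifferentiableAt ℂ (moment r w f) p ∧
      ∀ V : VF, along V (moment r w f) p = moment r w (alongS V f) p := by
  have hcont : ContinuousOn (Function.uncurry fun (q : Pt) (z : ℂ) => f (q, ![z, 1]) * w z)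
      (M ×ˢ sphere (0 : ℂ) r) := by
    refine ContinuousOn.mul (hf.continuousOn.comp
      (f := fun x : Pt × ℂ => ((x.1, ![x.2, 1]) : Pt × Spinor)) ?_ fun x hx => ⟨hx.1, hC _ hx.2⟩)
      (hw.comp continuousOn_snd fun x hx => hx.2)
    exact continuousOn_fst.prodMk (continuousOn_affine continuousOn_snd)
  have hd : ∀ z ∈ sphere (0 : ℂ) r, DifferentiableOn ℂ (fun q => f (q, ![z, 1]) * w z) M :=
    fun z hz => (differentiableOn_slice hf (hC z hz)).mul_const _
  have key := (hasFDerivAt_circleIntegral hM hr hcont hd hp).const_mul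
    (2 * Real.pi * Complex.I : ℂ)⁻¹
  refine ⟨key.differentiableAt, fun V => ?_⟩
  have hint := (continuousOn_fderiv_param hM (isCompact_sphere (0 : ℂ) r) hcont hd hp)
  unfold along
  rw [show moment r w f = fun y => (2 * Real.pi * Complex.I : ℂ)⁻¹ *
    ∮ z in C(0, r), f (y, ![z, 1]) * w z from rfl, key.fderiv]
  rw [smul_apply, smul_eq_mul]
  unfold moment
  congr 1
  unfold circleIntegral
  rw [ContinuousLinearMap.intervalIntegral_apply (hint.circleIntegrable hr).out]
  congr 1
  ext θ
  have hz := circleMap_mem_sphere (0 : ℂ) hr θ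
  have hdz := (differentiableOn_slice hf (hC _ hz)).differentiableAt (hM.mem_nhds hp)
  rw [fderiv_mul_const hdz]
  simp only [smul_apply, smul_eq_mul]
  unfold alongS along
  ring

end SpinBundle

/-! ### The recursion relations of the moments, and the wave equation -/

section LaurentCoefficients

variable {M : Set Pt} {C : Set Spinor} {f g : Pt × Spinor → ℂ} {n : ℕ}

theorem isTwistorFunction_iff {T : Frame} : IsTwistorFunction M T C n f ↔ IsSection M C n f ∧
    ∀ A, ∀ p ∈ M, ∀ π ∈ C, π 1 * alongS (T A 0) f (p, π) = π 0 * alongS (T A 1) f (p, π) := by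
  unfold IsTwistorFunction
  refine and_congr_right fun _ => ?_
  refine forall₅_congr fun A p _ π _ => ?_
  rw [Fin.sum_univ_two, ← sub_eq_zero (a := π 1 * _)]
  simp [up, alongS, sub_eq_add_neg]

theorem isRecursion_iff {T : Frame} {φ ψ : Pt → ℂ} : IsRecursion M T φ ψ ↔
    WaveSolution M T φ ∧ WaveSolution M T ψ ∧
      ∀ A, ∀ p ∈ M, along (T A 1) φ p = along (T A 0) ψ p := by
  simp [IsRecursion, Fin.sum_univ_two, iotaUp, oUp]

theorem along_neg (V : VF) (φ : Pt → ℂ) (p : Pt) :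
    along V (fun q => -φ q) p = -along V φ p := by
  unfold along
  rw [fderiv_fun_neg]
  rfl

/-- `□φ` in terms of the tetrad. -/
theorem box_eq (T : Frame) (φ : Pt → ℂ) (p : Pt) :
    box T φ p = along (T 0 1) (along (T 1 0) φ) p - along (T 1 1) (along (T 0 0) φ) p := by
  unfold box
  rw [Fin.sum_univ_two, sub_eq_add_neg, ← along_neg]
  rfl

theorem along_along_sub {V W : VF} (hM : IsOpen M) (hV : DifferentiableOn ℂ V M)
    (hW : DifferentiableOn ℂ W M) {φ : Pt → ℂ} (hφ : DifferentiableOn ℂ φ M) {p : Pt}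
    (hp : p ∈ M) : along V (along W φ) p - along W (along V φ) p
      = fderiv ℂ φ p (VectorField.lieBracket ℂ V W p) := by
  have h2 : ContDiffAt ℂ 2 φ p :=
    (contDiffOn_of_differentiableOn hM hφ 2).contDiffAt (hM.mem_nhds hp)
  exact (VectorField.fderiv_apply_lieBracket_of_isSymmSndFDerivAt h2
    (h2.isSymmSndFDerivAt (by simp)) (hW.differentiableAt (hM.mem_nhds hp))
    (hV.differentiableAt (hM.mem_nhds hp))).symm

/-- If `∇_{A0'} φ = ∇_{A1'} ψ` then `□φ = [∇_{01'}, ∇_{11'}] ψ = 0`. -/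
theorem waveSolution_of_along_eq (hM : IsOpen M) {T : Frame} (hT : IsASDVacuumTetrad M T)
    {φ ψ : Pt → ℂ} (hφ : DifferentiableOn ℂ φ M) (hψ : DifferentiableOn ℂ ψ M)
    (h : ∀ A, ∀ p ∈ M, along (T A 0) φ p = along (T A 1) ψ p) : WaveSolution M T φ := by
  refine ⟨hφ, fun p hp => ?_⟩
  rw [box_eq, along_congr hM (h 1) hp, along_congr hM (h 0) hp,
    along_along_sub hM (hT.holomorphic 0 1) (hT.holomorphic 1 1) hψ hp, hT.eq_one_one 0 1 p hp,
    map_zero]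

theorem continuousOn_inv_pow {r : ℝ} (hr : 0 < r) (k : ℕ) :
    ContinuousOn (fun z : ℂ => (z ^ k)⁻¹) (sphere 0 r) :=
  ContinuousOn.inv₀ (by fun_prop) fun _ hz => pow_ne_zero k (ne_of_mem_sphere hz hr.ne')

theorem differentiableOn_inv_pow {a : ℝ} (ha : 0 ≤ a) (b : ℝ) (k : ℕ) :
    DifferentiableOn ℂ (fun z : ℂ => (z ^ k)⁻¹) (annulus a b) := fun _ hz =>
  (DifferentiableAt.fun_inv (differentiableAt_id.fun_pow k) (pow_ne_zero k
    (norm_pos_iff.1 (ha.trans_lt hz.1)))).differentiableWithinAt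

theorem affine_mem_overlap_of_sphere {ε r : ℝ} (hr : r ∈ Ioo (1 - ε) (1 + ε)) {z : ℂ}
    (hz : z ∈ sphere (0 : ℂ) r) : ![z, 1] ∈ patchU ε ∩ patchU' ε :=
  affine_mem_overlap.2 (sphere_subset_annulus hr hz)

section Overlap

variable {T : Frame} {ε r : ℝ}

theorem differentiableOn_moment (hM : IsOpen M) (hε : ε < 1) (hr : r ∈ Ioo (1 - ε) (1 + ε))
    (hf : DifferentiableOn ℂ f (M ×ˢ (patchU ε ∩ patchU' ε))) (k : ℕ) :
    DifferentiableOn ℂ (moment r (fun z => (z ^ k)⁻¹) f) M := fun p hp =>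
  have hr0 : 0 < r := by linarith [hr.1]
  (hasFDerivAt_moment hM hr0.le (continuousOn_inv_pow hr0 k) hf
    (fun _ hz => affine_mem_overlap_of_sphere hr hz) hp).1.differentiableWithinAt

theorem along_moment (hM : IsOpen M) (hε : ε < 1) (hr : r ∈ Ioo (1 - ε) (1 + ε))
    (hf : DifferentiableOn ℂ f (M ×ˢ (patchU ε ∩ patchU' ε))) (k : ℕ) (V : VF) {p : Pt}
    (hp : p ∈ M) : along V (moment r (fun z => (z ^ k)⁻¹) f) p
      = moment r (fun z => (z ^ k)⁻¹) (alongS V f) p :=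
  have hr0 : 0 < r := by linarith [hr.1]
  (hasFDerivAt_moment hM hr0.le (continuousOn_inv_pow hr0 k) hf
    (fun _ hz => affine_mem_overlap_of_sphere hr hz) hp).2 V

/-- The Laurent coefficients `f_k` of a twistor function satisfy
`∇_{A0'} f_{k+1} = ∇_{A1'} f_k`. -/
theorem along_moment_succ (hM : IsOpen M) (hε : ε < 1) (hr : r ∈ Ioo (1 - ε) (1 + ε))
    (hf : IsTwistorFunction M T (patchU ε ∩ patchU' ε) n f) (k : ℕ) (A : Fin 2) {p : Pt}
    (hp : p ∈ M) : along (T A 0) (moment r (fun z => (z ^ (k + 1))⁻¹) f) p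
      = along (T A 1) (moment r (fun z => (z ^ k)⁻¹) f) p := by
  have hr0 : 0 < r := by linarith [hr.1]
  rw [isTwistorFunction_iff] at hf
  rw [along_moment hM hε hr hf.1.1 _ _ hp, along_moment hM hε hr hf.1.1 _ _ hp]
  refine moment_congr hr0.le fun z hz => ?_
  have h := hf.2 A p hp _ (affine_mem_overlap_of_sphere hr hz)
  simp only [Matrix.cons_val_zero, Matrix.cons_val_one, Matrix.cons_val_fin_one, one_mul] at h
  have hz0 : z ≠ 0 := ne_of_mem_sphere hz hr0.ne'
  rw [h, pow_succ]
  field_simp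

theorem along_neg_moment_succ (hM : IsOpen M) (hε : ε < 1) (hr : r ∈ Ioo (1 - ε) (1 + ε))
    (hf : IsTwistorFunction M T (patchU ε ∩ patchU' ε) n f) (k : ℕ) (A : Fin 2) {p : Pt}
    (hp : p ∈ M) : along (T A 0) (fun q => -moment r (fun z => (z ^ (k + 1))⁻¹) f q) p
      = along (T A 1) (fun q => -moment r (fun z => (z ^ k)⁻¹) f q) p := by
  rw [along_neg, along_neg, along_moment_succ hM hε hr hf k A hp]

theorem waveSolution_moment (hM : IsOpen M) (hT : IsASDVacuumTetrad M T) (hε : ε < 1)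
    (hr : r ∈ Ioo (1 - ε) (1 + ε)) (hf : IsTwistorFunction M T (patchU ε ∩ patchU' ε) n f)
    (k : ℕ) : WaveSolution M T (fun q => -moment r (fun z => (z ^ (k + 1))⁻¹) f q) :=
  waveSolution_of_along_eq hM hT (differentiableOn_moment hM hε hr hf.1.1 _).neg
    (differentiableOn_moment hM hε hr hf.1.1 k).neg
    fun A _ hp => along_neg_moment_succ hM hε hr hf k A hp

/-- Consecutive Laurent coefficients of a twistor function are related by the recursion operator. -/
theorem isRecursion_moment (hM : IsOpen M) (hT : IsASDVacuumTetrad M T) (hε : ε < 1)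
    (hr : r ∈ Ioo (1 - ε) (1 + ε)) (hf : IsTwistorFunction M T (patchU ε ∩ patchU' ε) n f)
    (k : ℕ) : IsRecursion M T (fun q => -moment r (fun z => (z ^ (k + 1))⁻¹) f q)
      (fun q => -moment r (fun z => (z ^ (k + 2))⁻¹) f q) :=
  isRecursion_iff.2 ⟨waveSolution_moment hM hT hε hr hf k, waveSolution_moment hM hT hε hr hf _,
    fun A _ hp => (along_neg_moment_succ hM hε hr hf _ A hp).symm⟩

theorem isTwistorFunction_lambdaInv (hM : IsOpen M) (hε : ε < 1)
    (hf : IsTwistorFunction M T (patchU ε ∩ patchU' ε) n f) :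
    IsTwistorFunction M T (patchU ε ∩ patchU' ε) n (lambdaInv f) := by
  rw [isTwistorFunction_iff] at hf ⊢
  have hne : ∀ π ∈ patchU ε ∩ patchU' ε, π 0 ≠ 0 := fun π hπ => ne_zero_of_mem_patchU' hε hπ.2
  have hal : ∀ (V : VF), ∀ p ∈ M, ∀ π ∈ patchU ε ∩ patchU' ε,
      alongS V (lambdaInv f) (p, π) = π 1 / π 0 * alongS V f (p, π) := by
    intro V p hp π hπ
    have hd := (differentiableOn_slice hf.1.1 hπ).differentiableAt (hM.mem_nhds hp)
    exact congrArg (fun L : Pt →L[ℂ] ℂ => L (V p)) (fderiv_const_mul hd (π 1 / π 0))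
  refine ⟨⟨?_, fun p hp π hπ t ht => ?_⟩, fun A p hp π hπ => ?_⟩
  · have hl : DifferentiableOn ℂ (fun q : Pt × Spinor => q.2 1 / q.2 0)
        (M ×ˢ (patchU ε ∩ patchU' ε)) :=
      DifferentiableOn.fun_mul (a := fun q : Pt × Spinor => q.2 1)
        (b := fun q : Pt × Spinor => (q.2 0)⁻¹) (by fun_prop)
        (DifferentiableOn.fun_inv (by fun_prop) fun q hq => hne _ hq.2)
    exact hl.mul hf.1.1
  · simp only [lambdaInv, Pi.smul_apply, smul_eq_mul, hf.1.2 p hp π hπ t ht]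
    have := hne π hπ
    field_simp
  · rw [hal _ p hp π hπ, hal _ p hp π hπ, mul_left_comm, hf.2 A p hp π hπ, mul_left_comm]

theorem moment_lambdaInv (hr : 0 < r) (k : ℕ) (p : Pt) :
    moment r (fun z => (z ^ k)⁻¹) (lambdaInv f) p = moment r (fun z => (z ^ (k + 1))⁻¹) f p := by
  refine moment_congr hr.le fun z hz => ?_
  have hz0 : z ≠ 0 := ne_of_mem_sphere hz hr.ne'
  simp only [lambdaInv, Matrix.cons_val_zero, Matrix.cons_val_one, Matrix.cons_val_fin_one]
  rw [pow_succ]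
  field_simp

end Overlap

end LaurentCoefficients

/-! ### Splitting a section over the overlap -/

section Splittings

variable {M : Set Pt} {C : Set Spinor} {f g h : Pt × Spinor → ℂ} {n : ℕ}

/-- The Cauchy integral `(2πi)⁻¹ ∮ h(p, (z, 1)) / (z³ (z π_{1'} - π_{0'})) dz` over `|z| = s`. For
`h` of degree two, multiplication by `π_{0'}³` gives the part of the Laurent series of `h` with
powers at least three if `|λ| < s`, and minus the part with powers at most two if `|λ| > s`. -/
def cauchyKernel (h : Pt × Spinor → ℂ) (s : ℝ) (q : Pt × Spinor) : ℂ :=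
  moment s (fun z => (z ^ 3 * (z * q.2 1 - q.2 0))⁻¹) h q.1

section Kernel

variable {ε s t : ℝ}

theorem kernel_ne_zero (hs : 0 < s) {π : Spinor} (hπ : ‖π 0‖ ≠ s * ‖π 1‖) {z : ℂ}
    (hz : z ∈ sphere (0 : ℂ) s) : z ^ 3 * (z * π 1 - π 0) ≠ 0 := by
  refine mul_ne_zero (pow_ne_zero 3 (ne_of_mem_sphere hz hs.ne')) fun h0 => hπ ?_
  rw [mem_sphere_zero_iff_norm] at hz
  rw [← sub_eq_zero.1 h0, norm_mul, hz]

theorem differentiableOn_cauchyKernel (hM : IsOpen M) (hε : ε < 1)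
    (hs : s ∈ Ioo (1 - ε) (1 + ε)) (hh : DifferentiableOn ℂ h (M ×ˢ (patchU ε ∩ patchU' ε))) :
    DifferentiableOn ℂ (cauchyKernel h s) (M ×ˢ {π | ‖π 0‖ ≠ s * ‖π 1‖}) := by
  have hs0 : 0 < s := by linarith [hs.1]
  have hopen : IsOpen (M ×ˢ {π : Spinor | ‖π 0‖ ≠ s * ‖π 1‖}) :=
    hM.prod (isOpen_ne_fun (by fun_prop) (by fun_prop))
  intro q hq
  refine (((hasFDerivAt_circleIntegral hopen hs0.le
    (G := fun q z => h (q.1, ![z, 1]) * (z ^ 3 * (z * q.2 1 - q.2 0))⁻¹) ?_ ?_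
    hq).const_mul _).differentiableAt).differentiableWithinAt
  · refine ContinuousOn.mul (hh.continuousOn.comp
      (f := fun x : (Pt × Spinor) × ℂ => ((x.1.1, ![x.2, 1]) : Pt × Spinor)) ?_
      fun x hx => ⟨hx.1.1, affine_mem_overlap_of_sphere hs hx.2⟩)
      (ContinuousOn.inv₀ (by fun_prop) fun x hx => kernel_ne_zero hs0 hx.1.2 hx.2)
    exact (continuous_fst.comp continuous_fst).continuousOn.prodMk
      (continuousOn_affine continuousOn_snd)
  · intro z hz
    refine DifferentiableOn.mul ?_
      (DifferentiableOn.fun_inv (by fun_prop) fun x hx => kernel_ne_zero hs0 hx.2 hz)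
    exact (differentiableOn_slice hh (affine_mem_overlap_of_sphere hs hz)).comp
      differentiableOn_fst fun x hx => hx.1

theorem alongS_cauchyKernel (hM : IsOpen M) (hε : ε < 1)
    (hs : s ∈ Ioo (1 - ε) (1 + ε)) (hh : DifferentiableOn ℂ h (M ×ˢ (patchU ε ∩ patchU' ε)))
    (V : VF) {p : Pt} (hp : p ∈ M) {π : Spinor} (hπ : ‖π 0‖ ≠ s * ‖π 1‖) :
    alongS V (cauchyKernel h s) (p, π) = cauchyKernel (alongS V h) s (p, π) := by
  have hs0 : 0 < s := by linarith [hs.1]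
  exact (hasFDerivAt_moment hM hs0.le (ContinuousOn.inv₀ (by fun_prop)
    fun z hz => kernel_ne_zero hs0 hπ hz) hh
    (fun _ hz => affine_mem_overlap_of_sphere hs hz) hp).2 V

/-- The Cauchy integral does not depend on the circle as long as the pole is not crossed. -/
theorem cauchyKernel_eq (hε : ε < 1) (hs : s ∈ Ioo (1 - ε) (1 + ε))
    (ht : t ∈ Ioo (1 - ε) (1 + ε)) (hh : DifferentiableOn ℂ h (M ×ˢ (patchU ε ∩ patchU' ε)))
    {p : Pt} (hp : p ∈ M) {π : Spinor}
    (hπ : ‖π 0‖ < s * ‖π 1‖ ∧ ‖π 0‖ < t * ‖π 1‖ ∨ s * ‖π 1‖ < ‖π 0‖ ∧ t * ‖π 1‖ < ‖π 0‖) :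
    cauchyKernel h s (p, π) = cauchyKernel h t (p, π) := by
  wlog hst : s ≤ t generalizing s t
  · exact (this ht hs (hπ.imp And.symm And.symm) (le_of_not_ge hst)).symm
  have hs0 : 0 < s := by linarith [hs.1]
  unfold cauchyKernel moment
  rw [circleIntegral_eq_of_differentiableAt hs0 hst fun z h1 h2 => ?_]
  have hz : z ∈ annulus (1 - ε) (1 + ε) := ⟨hs.1.trans_le h1, h2.trans_lt ht.2⟩
  have hne : ‖π 0‖ ≠ ‖z‖ * ‖π 1‖ := by
    rcases hπ with hπ | hπ
    · exact (hπ.1.trans_le (mul_le_mul_of_nonneg_right h1 (norm_nonneg _))).ne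
    · exact ((mul_le_mul_of_nonneg_right h2 (norm_nonneg _)).trans_lt hπ.2).ne'
  refine DifferentiableAt.mul ?_ (DifferentiableAt.fun_inv (by fun_prop)
    (kernel_ne_zero (hs0.trans_le h1) hne (by simp)))
  exact (differentiableOn_affine hh hp fun z hz => affine_mem_overlap.2 hz).differentiableAt
    ((isOpen_annulus _ _).mem_nhds hz)

/-- The jump of the Cauchy integral across the pole. -/
theorem cauchyKernel_sub (hε : ε < 1) (hs : s ∈ Ioo (1 - ε) (1 + ε))
    (ht : t ∈ Ioo (1 - ε) (1 + ε)) (hh : IsSection M (patchU ε ∩ patchU' ε) 2 h)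
    {p : Pt} (hp : p ∈ M) {π : Spinor} (h1 : ‖π 0‖ < t * ‖π 1‖) (h2 : s * ‖π 1‖ < ‖π 0‖) :
    π 0 ^ 3 * cauchyKernel h t (p, π) - π 0 ^ 3 * cauchyKernel h s (p, π) = h (p, π) := by
  have hs0 : 0 < s := by linarith [hs.1]
  have hn1 : 0 < ‖π 1‖ := by
    by_contra hneg
    have : ‖π 1‖ = 0 := le_antisymm (not_lt.1 hneg) (norm_nonneg _)
    rw [this, mul_zero] at h1 h2
    exact h1.not_gt h2
  have hπ1 : π 1 ≠ 0 := norm_pos_iff.1 hn1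
  have hπ0 : π 0 ≠ 0 := norm_pos_iff.1 ((mul_pos hs0 hn1).trans h2)
  have hsl : s < ‖π 0 / π 1‖ := by rwa [norm_div, lt_div_iff₀ hn1]
  have hlt : ‖π 0 / π 1‖ < t := by rwa [norm_div, div_lt_iff₀ hn1]
  have hl : π 0 / π 1 ∈ annulus (1 - ε) (1 + ε) := ⟨hs.1.trans hsl, hlt.trans ht.2⟩
  have hg : DifferentiableOn ℂ (fun z => h (p, ![z, 1]) * (z ^ 3)⁻¹)
      (annulus (1 - ε) (1 + ε)) :=
    (differentiableOn_affine hh.1 hp fun z hz => affine_mem_overlap.2 hz).mul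
      (differentiableOn_inv_pow (by linarith) _ 3)
  have key := circleIntegral_sub_circleIntegral (by linarith) hg hs ht hsl hlt
  have hK : ∀ u ∈ Ioo (1 - ε) (1 + ε), cauchyKernel h u (p, π) = (2 * Real.pi * Complex.I)⁻¹ *
      ((π 1)⁻¹ * ∮ z in C(0, u), h (p, ![z, 1]) * (z ^ 3)⁻¹ / (z - π 0 / π 1)) := by
    intro u _
    unfold cauchyKernel moment
    rw [← circleIntegral.integral_const_mul (π 1)⁻¹]
    congr 2
    ext z
    have : z * π 1 - π 0 = π 1 * (z - π 0 / π 1) := by field_simp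
    simp only [this, mul_inv, div_eq_mul_inv]
    ring
  have hpi : (2 * Real.pi * Complex.I : ℂ) ≠ 0 := by simp [Real.pi_ne_zero]
  rw [hK t ht, hK s hs, ← mul_sub, ← mul_sub, ← mul_sub, key, inv_mul_eq_div, mul_div_assoc',
    hh.eq_affine hp hπ1 (affine_mem_overlap.2 hl)]
  field_simp

theorem cauchyKernel_smul (h : Pt × Spinor → ℂ) (s : ℝ) (p : Pt) (π : Spinor) (c : ℂ) :
    cauchyKernel h s (p, c • π) = c⁻¹ * cauchyKernel h s (p, π) := by
  unfold cauchyKernel moment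
  rw [mul_left_comm, ← circleIntegral.integral_const_mul c⁻¹]
  congr 2
  ext z
  have : z * (c • π) 1 - (c • π) 0 = c * (z * π 1 - π 0) := by
    simp only [Pi.smul_apply, smul_eq_mul]; ring
  simp only [this, mul_inv]
  ring

/-- The defect of the twistor equation for the two parts of a twistor function `h` is governed by
`∇_{A0'} h₃ = ∇_{A1'} h₂`. -/
theorem twistor_defect_cauchyKernel (hM : IsOpen M) {T : Frame}
    (hε : ε < 1) (hs : s ∈ Ioo (1 - ε) (1 + ε))
    (hh : IsTwistorFunction M T (patchU ε ∩ patchU' ε) n h) (A : Fin 2) {p : Pt} (hp : p ∈ M)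
    {π : Spinor} (hπ : ‖π 0‖ ≠ s * ‖π 1‖) (hT : ∀ A A', DifferentiableOn ℂ (T A A') M) :
    π 1 * alongS (T A 0) (cauchyKernel h s) (p, π) - π 0 * alongS (T A 1) (cauchyKernel h s) (p, π)
      = along (T A 0) (moment s (fun z => (z ^ 4)⁻¹) h) p := by
  have hs0 : 0 < s := by linarith [hs.1]
  have hcont : ∀ V, DifferentiableOn ℂ V M → ContinuousOn (fun z : ℂ =>
      alongS V h (p, ![z, 1]) * (z ^ 3 * (z * π 1 - π 0))⁻¹) (sphere 0 s) := fun V hV =>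
    ((differentiableOn_affine (differentiableOn_alongS hM (isOpen_overlap ε) hV hh.1.1) hp
      fun z hz => affine_mem_overlap_of_sphere hs hz).continuousOn).mul
      (ContinuousOn.inv₀ (by fun_prop) fun z hz => kernel_ne_zero hs0 hπ hz)
  rw [along_moment_succ hM hε hs hh, along_moment hM hε hs hh.1.1 _ _ hp]
  rw [isTwistorFunction_iff] at hh
  rw [alongS_cauchyKernel hM hε hs hh.1.1 _ hp hπ, alongS_cauchyKernel hM hε hs hh.1.1 _ hp hπ]
  unfold cauchyKernel moment
  rw [mul_left_comm, mul_left_comm (π 0), ← mul_sub, ← circleIntegral.integral_const_mul,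
    ← circleIntegral.integral_const_mul, ← circleIntegral.integral_sub]
  · congr 1
    refine circleIntegral.integral_congr hs0.le fun z hz => ?_
    have htw := hh.2 A p hp _ (affine_mem_overlap_of_sphere hs hz)
    simp only [Matrix.cons_val_zero, Matrix.cons_val_one, Matrix.cons_val_fin_one, one_mul] at htw
    have hne := kernel_ne_zero hs0 hπ hz
    have hz0 : z ≠ 0 := ne_of_mem_sphere hz hs0.ne'
    have hne' : π 1 * z - π 0 ≠ 0 := by
      rw [mul_comm]; exact right_ne_zero_of_mul hne
    simp only [htw]
    field_simp
  · exact (continuousOn_const.mul (hcont _ (hT A 0))).circleIntegrable hs0.le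
  · exact (continuousOn_const.mul (hcont _ (hT A 1))).circleIntegrable hs0.le
  · exact hp

end Kernel

section Splitting

variable {ε : ℝ}

theorem exists_radius_of_mem_patchU (hε₀ : 0 < ε) {π : Spinor} (hπ : π ∈ patchU ε) :
    ∃ s ∈ Ioo (1 - ε) (1 + ε), ‖π 0‖ < s * ‖π 1‖ := by
  have h1 : 0 < ‖π 1‖ := norm_pos_iff.2 (ne_zero_of_mem_patchU hπ)
  have h : ‖π 0‖ / ‖π 1‖ < 1 + ε := (div_lt_iff₀ h1).2 hπ
  obtain ⟨s, hs, hs'⟩ := exists_between (max_lt h (by linarith : 1 - ε < 1 + ε))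
  rw [max_lt_iff] at hs
  exact ⟨s, ⟨hs.2, hs'⟩, (div_lt_iff₀ h1).1 hs.1⟩

theorem exists_radius_of_mem_patchU' (hε₀ : 0 < ε) {π : Spinor} (hπ : π ∈ patchU' ε) :
    ∃ s ∈ Ioo (1 - ε) (1 + ε), s * ‖π 1‖ < ‖π 0‖ := by
  have hcont : Filter.Tendsto (fun s : ℝ => s * ‖π 1‖) (𝓝[>] (1 - ε)) (𝓝 ((1 - ε) * ‖π 1‖)) :=
    ((by fun_prop : Continuous fun s : ℝ => s * ‖π 1‖).tendsto _).mono_left nhdsWithin_le_nhds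
  obtain ⟨s, hs, hs'⟩ := ((hcont.eventually_lt_const hπ).and
    (Ioo_mem_nhdsGT (by linarith : 1 - ε < 1 + ε))).exists
  exact ⟨s, hs', hs⟩

/-- Every section of degree two over the overlap is a difference of a section over `U` vanishing to
third order at `λ = 0` and a section over `Ũ`; the two parts are given by Cauchy integrals. -/
theorem exists_splitting (hM : IsOpen M) (hε₀ : 0 < ε) (hε : ε < 1)
    (hh : IsSection M (patchU ε ∩ patchU' ε) 2 h) :
    ∃ b a' : Pt × Spinor → ℂ, DifferentiableOn ℂ b (M ×ˢ patchU ε) ∧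
      (∀ p ∈ M, ∀ π ∈ patchU ε, ∀ t : ℂ, t ≠ 0 → b (p, t • π) = t⁻¹ * b (p, π)) ∧
      IsSection M (patchU' ε) 2 a' ∧
      (∀ p ∈ M, ∀ π ∈ patchU ε ∩ patchU' ε, h (p, π) = π 0 ^ 3 * b (p, π) - a' (p, π)) ∧
      (∀ π ∈ patchU ε, ∃ s ∈ Ioo (1 - ε) (1 + ε), ‖π 0‖ < s * ‖π 1‖ ∧
        ∀ p ∈ M, b (p, π) = cauchyKernel h s (p, π)) ∧
      ∀ π ∈ patchU' ε, ∃ s ∈ Ioo (1 - ε) (1 + ε), s * ‖π 1‖ < ‖π 0‖ ∧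
        ∀ p ∈ M, a' (p, π) = π 0 ^ 3 * cauchyKernel h s (p, π) := by
  choose! σ hσ hσπ using fun π hπ => exists_radius_of_mem_patchU (ε := ε) (π := π) hε₀ hπ
  choose! τ hτ hτπ using fun π hπ => exists_radius_of_mem_patchU' (ε := ε) (π := π) hε₀ hπ
  have hb : ∀ p ∈ M, ∀ π ∈ patchU ε, ∀ s ∈ Ioo (1 - ε) (1 + ε), ‖π 0‖ < s * ‖π 1‖ →
      cauchyKernel h (σ π) (p, π) = cauchyKernel h s (p, π) := fun p hp π hπ s hs hsπ =>
    cauchyKernel_eq hε (hσ π hπ) hs hh.1 hp (Or.inl ⟨hσπ π hπ, hsπ⟩)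
  have ha : ∀ p ∈ M, ∀ π ∈ patchU' ε, ∀ s ∈ Ioo (1 - ε) (1 + ε), s * ‖π 1‖ < ‖π 0‖ →
      cauchyKernel h (τ π) (p, π) = cauchyKernel h s (p, π) := fun p hp π hπ s hs hsπ =>
    cauchyKernel_eq hε (hτ π hπ) hs hh.1 hp (Or.inr ⟨hτπ π hπ, hsπ⟩)
  refine ⟨fun q => cauchyKernel h (σ q.2) q, fun q => q.2 0 ^ 3 * cauchyKernel h (τ q.2) q,
    ?_, ?_, ⟨?_, ?_⟩, ?_, fun π hπ => ⟨σ π, hσ π hπ, hσπ π hπ, fun p _ => rfl⟩,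
    fun π hπ => ⟨τ π, hτ π hπ, hτπ π hπ, fun p _ => rfl⟩⟩
  · -- Near a given spinor the radius may be kept fixed.
    rintro ⟨p, π⟩ ⟨hp, hπ⟩
    have hopen : (M ×ˢ patchU ε) ∩ (M ×ˢ {χ : Spinor | ‖χ 0‖ < σ π * ‖χ 1‖}) ∈ 𝓝 (p, π) :=
      ((hM.prod (isOpen_patchU ε)).inter
        (hM.prod (isOpen_lt (by fun_prop) (by fun_prop)))).mem_nhds ⟨⟨hp, hπ⟩, hp, hσπ π hπ⟩
    have hd := ((differentiableOn_cauchyKernel hM hε (hσ π hπ) hh.1).mono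
      (prod_mono Subset.rfl fun χ (hχ : ‖χ 0‖ < σ π * ‖χ 1‖) => hχ.ne)).differentiableAt
      (Filter.mem_of_superset hopen inter_subset_right)
    refine (hd.congr_of_eventuallyEq
      (Filter.eventuallyEq_of_mem hopen fun q hq => ?_)).differentiableWithinAt
    exact hb q.1 hq.1.1 q.2 hq.1.2 _ (hσ π hπ) hq.2.2
  · intro p hp π hπ t ht
    have hlt := hσπ _ (smul_mem_patchU ht hπ)
    simp only [Pi.smul_apply, smul_eq_mul, norm_mul] at hlt
    rw [mul_left_comm] at hlt
    simp only
    rw [cauchyKernel_smul, hb p hp π hπ _ (hσ _ (smul_mem_patchU ht hπ))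
      (lt_of_mul_lt_mul_left hlt (norm_nonneg t))]
  · rintro ⟨p, π⟩ ⟨hp, hπ⟩
    have hopen : (M ×ˢ patchU' ε) ∩ (M ×ˢ {χ : Spinor | τ π * ‖χ 1‖ < ‖χ 0‖}) ∈ 𝓝 (p, π) :=
      ((hM.prod (isOpen_patchU' ε)).inter
        (hM.prod (isOpen_lt (by fun_prop) (by fun_prop)))).mem_nhds ⟨⟨hp, hπ⟩, hp, hτπ π hπ⟩
    have hd := ((differentiableOn_cauchyKernel hM hε (hτ π hπ) hh.1).mono
      (prod_mono Subset.rfl fun χ (hχ : τ π * ‖χ 1‖ < ‖χ 0‖) => hχ.ne')).differentiableAt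
      (Filter.mem_of_superset hopen inter_subset_right)
    have hd' : DifferentiableAt ℂ (fun q => cauchyKernel h (τ q.2) q) (p, π) :=
      hd.congr_of_eventuallyEq (Filter.eventuallyEq_of_mem hopen fun q hq =>
        ha q.1 hq.1.1 q.2 hq.1.2 _ (hτ π hπ) hq.2.2)
    have hd0 : DifferentiableAt ℂ (fun q : Pt × Spinor => q.2 0 ^ 3) (p, π) := by fun_prop
    exact (hd0.fun_mul hd').differentiableWithinAt
  · intro p hp π hπ t ht
    have hlt := hτπ _ (smul_mem_patchU' ht hπ)
    simp only [Pi.smul_apply, smul_eq_mul, norm_mul] at hlt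
    rw [mul_left_comm] at hlt
    simp only [Pi.smul_apply, smul_eq_mul]
    rw [cauchyKernel_smul, ha p hp π hπ _ (hτ _ (smul_mem_patchU' ht hπ))
      (lt_of_mul_lt_mul_left hlt (norm_nonneg t))]
    field_simp
  · intro p hp π hπ
    exact (cauchyKernel_sub hε (hτ π hπ.2) (hσ π hπ.1) hh hp (hσπ π hπ.1) (hτπ π hπ.2)).symm

/-- The moments of a section over `Ũ` against sufficiently negative powers of `λ` vanish. -/
theorem moment_eq_zero_of_patchU' (hε : ε < 1) {r : ℝ} (hr : r ∈ Ioo (1 - ε) (1 + ε))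
    (hf : IsSection M (patchU' ε) n f) {p : Pt} (hp : p ∈ M) :
    moment r (fun z => (z ^ (n + 2))⁻¹) f p = 0 := by
  have hr0 : 0 < r := by linarith [hr.1]
  have hd : DifferentiableOn ℂ (fun z : ℂ => f (p, ![1, z])) (ball 0 (1 - ε)⁻¹) :=
    differentiableOn_infinity hf.1 hp fun z hz => (infinity_mem_patchU' hε).2 hz
  have hrε : r⁻¹ < (1 - ε)⁻¹ := (inv_lt_inv₀ hr0 (by linarith)).2 hr.1
  have key := circleIntegral_inv_eq_zero hr0 hrε hd
  have heq : (∮ z in C(0, r), f (p, ![z, 1]) * (z ^ (n + 2))⁻¹)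
      = ∮ z in C(0, r), f (p, ![1, z⁻¹]) / z ^ 2 := by
    refine circleIntegral.integral_congr hr0.le fun z hz => ?_
    have hz0 : z ≠ 0 := ne_of_mem_sphere hz hr0.ne'
    have hmem : ![1, z⁻¹] ∈ patchU' ε := by
      rw [infinity_mem_patchU' hε, mem_ball_zero_iff, norm_inv, mem_sphere_zero_iff_norm.1 hz]
      exact hrε
    rw [hf.eq_infinity hp hz0 hmem, pow_add]
    field_simp
  unfold moment
  rw [heq, key, mul_zero]

end Splitting

/-! ### The cohomological freedom -/

section Cohomology

variable {ε : ℝ}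

theorem along_sub (V : VF) {φ ψ : Pt → ℂ} {p : Pt} (hφ : DifferentiableAt ℂ φ p)
    (hψ : DifferentiableAt ℂ ψ p) :
    along V (fun q => φ q - ψ q) p = along V φ p - along V ψ p := by
  unfold along
  rw [fderiv_fun_sub hφ hψ]
  rfl

theorem alongS_mul (hM : IsOpen M) (V : VF) (c : Spinor → ℂ)
    (hf : DifferentiableOn ℂ f (M ×ˢ C)) {p : Pt} (hp : p ∈ M) {π : Spinor} (hπ : π ∈ C) :
    alongS V (fun q => c q.2 * f q) (p, π) = c π * alongS V f (p, π) := by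
  have hd := (differentiableOn_slice hf hπ).differentiableAt (hM.mem_nhds hp)
  exact congrArg (fun L : Pt →L[ℂ] ℂ => L (V p)) (fderiv_const_mul hd (c π))

theorem isTwistorFunction_sub (hM : IsOpen M) {T : Frame} (hf : IsTwistorFunction M T C n f)
    (hg : IsTwistorFunction M T C n g) : IsTwistorFunction M T C n (fun q => f q - g q) := by
  rw [isTwistorFunction_iff] at hf hg ⊢
  refine ⟨⟨hf.1.1.sub hg.1.1, fun p hp π hπ t ht => ?_⟩, fun A p hp π hπ => ?_⟩
  · simp only
    rw [hf.1.2 p hp π hπ t ht, hg.1.2 p hp π hπ t ht, mul_sub]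
  · have h : ∀ V, alongS V (fun q => f q - g q) (p, π) = alongS V f (p, π) - alongS V g (p, π) :=
      fun V => along_sub V ((differentiableOn_slice hf.1.1 hπ).differentiableAt (hM.mem_nhds hp))
        ((differentiableOn_slice hg.1.1 hπ).differentiableAt (hM.mem_nhds hp))
    rw [h, h, mul_sub, mul_sub, hf.2 A p hp π hπ, hg.2 A p hp π hπ]

theorem IsTwistorFunction.mono {T : Frame} {C' : Set Spinor} (hf : IsTwistorFunction M T C n f)
    (h : C' ⊆ C) : IsTwistorFunction M T C' n f :=
  ⟨hf.1.mono h, fun A p hp π hπ => hf.2 A p hp π (h hπ)⟩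

theorem moment_sub (hε : ε < 1) {r : ℝ} (hr : r ∈ Ioo (1 - ε) (1 + ε)) (k : ℕ)
    (hf : DifferentiableOn ℂ f (M ×ˢ (patchU ε ∩ patchU' ε)))
    (hg : DifferentiableOn ℂ g (M ×ˢ (patchU ε ∩ patchU' ε))) {p : Pt} (hp : p ∈ M) :
    moment r (fun z => (z ^ k)⁻¹) (fun q => f q - g q) p
      = moment r (fun z => (z ^ k)⁻¹) f p - moment r (fun z => (z ^ k)⁻¹) g p := by
  have hr0 : 0 < r := by linarith [hr.1]
  have hint : ∀ u : Pt × Spinor → ℂ, DifferentiableOn ℂ u (M ×ˢ (patchU ε ∩ patchU' ε)) →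
      CircleIntegrable (fun z => u (p, ![z, 1]) * (z ^ k)⁻¹) 0 r := fun u hu =>
    ((differentiableOn_affine hu hp fun z hz => affine_mem_overlap_of_sphere hr hz).continuousOn.mul
      (continuousOn_inv_pow hr0 k)).circleIntegrable hr0.le
  unfold moment
  rw [← mul_sub, ← circleIntegral.integral_sub (hint f hf) (hint g hg)]
  simp only [sub_mul]

/-- The obstruction to splitting `h = f - g` into twistor functions in the Plebański gauge is
`∇_{A0'} h₃`, with `h₃` the Laurent coefficient. -/
theorem cohomologous_iff (hM : IsOpen M) {T : Frame} (hT : IsASDVacuumTetrad M T)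
    (hε₀ : 0 < ε) (hε : ε < 1) {r : ℝ} (hr : r ∈ Ioo (1 - ε) (1 + ε))
    (hf : IsTwistorFunction M T (patchU ε ∩ patchU' ε) 2 f)
    (hg : IsTwistorFunction M T (patchU ε ∩ patchU' ε) 2 g) :
    Cohomologous M T ε f g ↔ ∀ A, ∀ p ∈ M, along (T A 0) (moment r (fun z => (z ^ 4)⁻¹) f) p
      = along (T A 0) (moment r (fun z => (z ^ 4)⁻¹) g) p := by
  have hr0 : 0 < r := by linarith [hr.1]
  have hmd : ∀ u : Pt × Spinor → ℂ, IsTwistorFunction M T (patchU ε ∩ patchU' ε) 2 u →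
      ∀ p ∈ M, DifferentiableAt ℂ (moment r (fun z => (z ^ 4)⁻¹) u) p := fun u hu p hp =>
    (differentiableOn_moment hM hε hr hu.1.1 4).differentiableAt (hM.mem_nhds hp)
  have hsub : ∀ A, ∀ p ∈ M,
      along (T A 0) (moment r (fun z => (z ^ 4)⁻¹) fun q => f q - g q) p
        = along (T A 0) (moment r (fun z => (z ^ 4)⁻¹) f) p
          - along (T A 0) (moment r (fun z => (z ^ 4)⁻¹) g) p := fun A p hp => by
    rw [← along_sub _ (hmd f hf p hp) (hmd g hg p hp)]
    exact along_congr hM (fun q hq => moment_sub hε hr 4 hf.1.1 hg.1.1 hq) hp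
  constructor
  · rintro ⟨a, a', b, ha, ha', hb, hab, hfg⟩ A p hp
    have ha₁ := ha.mono (inter_subset_left (t := patchU' ε))
    have ha'₁ := ha'.mono (inter_subset_right (s := patchU ε))
    have h1 : ∀ q ∈ M, moment r (fun z => (z ^ 4)⁻¹) (fun q => f q - g q) q
        = moment r (fun z => (z ^ 4)⁻¹) a q := fun q hq => by
      rw [← sub_zero (moment r _ a q), ← moment_eq_zero_of_patchU' hε hr ha'.1 hq,
        ← moment_sub hε hr 4 ha₁.1.1 ha'₁.1.1 hq]
      refine moment_congr hr0.le fun z hz => ?_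
      rw [hfg q hq _ (affine_mem_overlap_of_sphere hr hz)]
    -- `a` is divisible by `λ³`, so its third moment is the integral of a holomorphic function.
    have h2 : ∀ q ∈ M, moment r (fun z => (z ^ 3)⁻¹) a q = 0 := fun q hq => by
      have hd : DifferentiableOn ℂ (fun z : ℂ => -b (q, ![z, 1])) (ball 0 (1 + ε)) :=
        (differentiableOn_affine hb hq fun z hz => affine_mem_patchU.2 hz).neg
      have heq : (∮ z in C(0, r), a (q, ![z, 1]) * (z ^ 3)⁻¹) = ∮ z in C(0, r), -b (q, ![z, 1]) := by
        refine circleIntegral.integral_congr hr0.le fun z hz => ?_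
        have hz0 : z ≠ 0 := ne_of_mem_sphere hz hr0.ne'
        rw [hab q hq _ (affine_mem_overlap_of_sphere hr hz).1, pair_low_oUp]
        simp only [Matrix.cons_val_zero]
        field_simp
      unfold moment
      rw [heq, circleIntegral_eq_zero_of_ball hr0 hr.2 hd, mul_zero]
    rw [← sub_eq_zero, ← hsub A p hp, along_congr hM h1 hp, along_moment_succ hM hε hr ha₁ 3 A hp,
      along_congr hM h2 hp]
    simp [along]
  · intro hfgT
    have hh := isTwistorFunction_sub hM hf hg
    obtain ⟨b, a', hb, hbh, ha', hsplit, hbK, ha'K⟩ := exists_splitting hM hε₀ hε hh.1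
    have hdef : ∀ s ∈ Ioo (1 - ε) (1 + ε), ∀ π : Spinor, ‖π 0‖ ≠ s * ‖π 1‖ → ∀ A, ∀ p ∈ M,
        π 1 * alongS (T A 0) (cauchyKernel (fun q => f q - g q) s) (p, π)
          = π 0 * alongS (T A 1) (cauchyKernel (fun q => f q - g q) s) (p, π) := by
      intro s hs π hπ A p hp
      rw [← sub_eq_zero, twistor_defect_cauchyKernel hM hε hs hh A hp hπ hT.holomorphic,
        along_congr hM (fun q hq => moment_eq_of_annulus hε
          (differentiableOn_inv_pow (by linarith) _ 4) hh.1.1 hq hs hr) hp, hsub A p hp,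
        hfgT A p hp, sub_self]
    have hal : ∀ s ∈ Ioo (1 - ε) (1 + ε), ∀ π : Spinor, ‖π 0‖ ≠ s * ‖π 1‖ →
        ∀ u : Pt × Spinor → ℂ,
        (∀ p ∈ M, u (p, π) = π 0 ^ 3 * cauchyKernel (fun q => f q - g q) s (p, π)) →
        ∀ A, ∀ p ∈ M, π 1 * alongS (T A 0) u (p, π) = π 0 * alongS (T A 1) u (p, π) := by
      intro s hs π hπ u hu A p hp
      have h1 : ∀ V, alongS V u (p, π)
          = π 0 ^ 3 * alongS V (cauchyKernel (fun q => f q - g q) s) (p, π) := fun V => by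
        rw [← alongS_mul hM V (fun π => π 0 ^ 3)
          (differentiableOn_cauchyKernel hM hε hs hh.1.1) hp hπ]
        exact alongS_congr hM (fun q hq => hu q hq) hp
      rw [h1, h1, mul_left_comm, hdef s hs π hπ A p hp, mul_left_comm]
    refine ⟨fun q => q.2 0 ^ 3 * b q, a', fun q => -b q, isTwistorFunction_iff.2 ⟨⟨?_, ?_⟩, ?_⟩,
      isTwistorFunction_iff.2 ⟨ha', ?_⟩, hb.neg, ?_, hsplit⟩
    · have h0 : DifferentiableOn ℂ (fun q : Pt × Spinor => q.2 0 ^ 3) (M ×ˢ patchU ε) := by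
        fun_prop
      exact h0.mul hb
    · intro p hp π hπ t ht
      simp only [Pi.smul_apply, smul_eq_mul]
      rw [hbh p hp π hπ t ht]
      field_simp
    · intro A p hp π hπ
      obtain ⟨s, hs, hsπ, hbs⟩ := hbK π hπ
      exact hal s hs π hsπ.ne _ (fun q hq => by simp only [hbs q hq]) A p hp
    · intro A p hp π hπ
      obtain ⟨s, hs, hsπ, has⟩ := ha'K π hπ
      exact hal s hs π hsπ.ne' _ has A p hp
    · intro p _ π _
      simp only [pair_low_oUp]
      ring

end Cohomology

end Splittings

/-! ### Coordinate changes and the Plebański forms -/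

section Coordinates

variable {M N : Set Pt} {c : Pt → Pt} {φ ψ : Pt → ℂ}

theorem hasStrictFDerivAt_of_surjective (hM : IsOpen M) (hc : DifferentiableOn ℂ c M) {p : Pt}
    (hp : p ∈ M) (hs : Function.Surjective (fderiv ℂ c p)) :
    ∃ L : Pt ≃L[ℂ] Pt, HasStrictFDerivAt c (L : Pt →L[ℂ] Pt) p := by
  have hinj : Function.Injective (fderiv ℂ c p : Pt →ₗ[ℂ] Pt) :=
    LinearMap.injective_iff_surjective.2 hs
  refine ⟨(LinearEquiv.ofBijective (fderiv ℂ c p : Pt →ₗ[ℂ] Pt)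
    ⟨hinj, hs⟩).toContinuousLinearEquiv, ?_⟩
  have h1 : ContDiffAt ℂ 1 c p :=
    (contDiffOn_of_differentiableOn hM hc 1).contDiffAt (hM.mem_nhds hp)
  exact h1.hasStrictFDerivAt one_ne_zero

theorem isOpen_image_of_surjective (hM : IsOpen M) (hc : DifferentiableOn ℂ c M)
    (hs : ∀ p ∈ M, Function.Surjective (fderiv ℂ c p)) : IsOpen (c '' M) := by
  rw [isOpen_iff_mem_nhds]
  rintro _ ⟨p, hp, rfl⟩
  obtain ⟨L, hL⟩ := hasStrictFDerivAt_of_surjective hM hc hp (hs p hp)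
  rw [← hL.map_nhds_eq_of_equiv]
  exact Filter.image_mem_map (hM.mem_nhds hp)

/-- A function is holomorphic if it is so after composition with a local biholomorphism. -/
theorem differentiableOn_of_comp (hM : IsOpen M) (hc : DifferentiableOn ℂ c M)
    (hs : ∀ p ∈ M, Function.Surjective (fderiv ℂ c p)) (hψ : DifferentiableOn ℂ ψ M)
    (h : ∀ p ∈ M, φ (c p) = ψ p) : DifferentiableOn ℂ φ (c '' M) := by
  rintro _ ⟨p, hp, rfl⟩
  obtain ⟨L, hL⟩ := hasStrictFDerivAt_of_surjective hM hc hp (hs p hp)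
  have hinv : HasFDerivAt (hL.localInverse c L p) (L.symm : Pt →L[ℂ] Pt) (c p) :=
    hL.to_localInverse.hasFDerivAt
  have himg : hL.localInverse c L p (c p) = p := hL.localInverse_apply_image
  have hmem : ∀ᶠ q in 𝓝 (c p), hL.localInverse c L p q ∈ M :=
    hinv.continuousAt.eventually_mem (by rw [himg]; exact hM.mem_nhds hp)
  have hψp : DifferentiableAt ℂ ψ (hL.localInverse c L p (c p)) := by
    rw [himg]; exact hψ.differentiableAt (hM.mem_nhds hp)
  refine DifferentiableAt.differentiableWithinAt
    ((hψp.comp (c p) hinv.differentiableAt).congr_of_eventuallyEq ?_)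
  filter_upwards [hmem, hL.eventually_right_inverse] with q hq hcq
  rw [Function.comp_apply, ← h _ hq, hcq]

theorem along_comp {V W : VF} (hM : IsOpen M) (hN : IsOpen N) (hMN : MapsTo c M N)
    (hc : DifferentiableOn ℂ c M) (hφ : DifferentiableOn ℂ φ N) (h : ∀ p ∈ M, φ (c p) = ψ p)
    {p : Pt} (hp : p ∈ M) (hVW : fderiv ℂ c p (V p) = W (c p)) :
    along W φ (c p) = along V ψ p := by
  rw [← along_congr hM h hp]
  have hφp := hφ.differentiableAt (hN.mem_nhds (hMN hp))
  have hcp := hc.differentiableAt (hM.mem_nhds hp)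
  have := fderiv_comp p hφp hcp
  unfold along
  rw [show (fun q => φ (c q)) = φ ∘ c from rfl, this, ContinuousLinearMap.comp_apply, hVW]

/-- The wave operator is natural under coordinate changes. -/
theorem box_comp {T S : Frame} (hM : IsOpen M) (hN : IsOpen N) (hMN : MapsTo c M N)
    (hc : DifferentiableOn ℂ c M) (hS : ∀ A A', DifferentiableOn ℂ (S A A') N)
    (hTS : ∀ A A', ∀ p ∈ M, fderiv ℂ c p (T A A' p) = S A A' (c p))
    (hφ : DifferentiableOn ℂ φ N) (h : ∀ p ∈ M, φ (c p) = ψ p)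
    {p : Pt} (hp : p ∈ M) : box S φ (c p) = box T ψ p := by
  have h1 : ∀ A A', ∀ q ∈ M, along (S A A') φ (c q) = along (T A A') ψ q := fun A A' q hq =>
    along_comp hM hN hMN hc hφ h hq (hTS A A' q hq)
  have h2 : ∀ A A' B B', along (S A A') (along (S B B') φ) (c p)
      = along (T A A') (along (T B B') ψ) p := fun A A' B B' =>
    along_comp hM hN hMN hc (differentiableOn_along hN (hS B B') hφ) (h1 B B') hp (hTS A A' p hp)
  rw [box_eq, box_eq, h2, h2]

theorem along_eq_sum (V : VF) (φ : Pt → ℂ) (q : Pt) :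
    along V φ q = V q 0 * pd 0 φ q + V q 1 * pd 1 φ q + V q 2 * pd 2 φ q + V q 3 * pd 3 φ q := by
  have hv : V q = ∑ i, V q i • (Pi.single i 1 : Pt) := by
    ext j
    simp [Finset.sum_apply, Pi.single_apply]
  unfold along
  conv_lhs => rw [hv]
  rw [map_sum, Fin.sum_univ_four]
  simp [pd]

theorem pd_eq_along (i : Fin 4) (φ : Pt → ℂ) : pd i φ = along (fun _ => Pi.single i 1) φ := rfl

theorem differentiableOn_pd (hN : IsOpen N) (hφ : DifferentiableOn ℂ φ N) (i : Fin 4) :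
    DifferentiableOn ℂ (pd i φ) N :=
  differentiableOn_along hN (differentiableOn_const _) hφ

theorem pd_comm (hN : IsOpen N) (hφ : DifferentiableOn ℂ φ N) (i j : Fin 4) {q : Pt}
    (hq : q ∈ N) : pd i (pd j φ) q = pd j (pd i φ) q := by
  rw [← sub_eq_zero]
  simp only [pd_eq_along]
  rw [along_along_sub hN (differentiableOn_const _) (differentiableOn_const _) hφ hq]
  simp [VectorField.lieBracket]

theorem pd_mul {q : Pt} (hφ : DifferentiableAt ℂ φ q) (hψ : DifferentiableAt ℂ ψ q) (i : Fin 4) :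
    pd i (fun x => φ x * ψ x) q = φ q * pd i ψ q + pd i φ q * ψ q := by
  unfold pd
  rw [fderiv_fun_mul hφ hψ]
  simp [mul_comm]

theorem pd_neg (i : Fin 4) (φ : Pt → ℂ) (q : Pt) : pd i (fun x => -φ x) q = -pd i φ q :=
  along_neg (fun _ => Pi.single i 1) φ q

theorem pd_add {q : Pt} (hφ : DifferentiableAt ℂ φ q) (hψ : DifferentiableAt ℂ ψ q) (i : Fin 4) :
    pd i (fun x => φ x + ψ x) q = pd i φ q + pd i ψ q := by
  unfold pd
  rw [fderiv_fun_add hφ hψ]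
  rfl

theorem differentiableOn_vec {v : Fin 4 → Pt → ℂ} (hv : ∀ i, DifferentiableOn ℂ (v i) N) :
    DifferentiableOn ℂ (fun q => ![v 0 q, v 1 q, v 2 q, v 3 q]) N := by
  refine differentiableOn_pi.2 fun i => ?_
  fin_cases i
  · exact hv 0
  · exact hv 1
  · exact hv 2
  · exact hv 3

end Coordinates

section SecondForm

variable {M N : Set Pt} {T : Frame} {c : Pt → Pt} {Θ φ : Pt → ℂ}

theorem IsSecondForm.surjective (h : IsSecondForm M T c Θ) :
    ∀ p ∈ M, Function.Surjective (fderiv ℂ c p) := by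
  intro p hp v
  set a := pd 3 (pd 3 Θ) (c p) with ha
  set b := pd 2 (pd 3 Θ) (c p) with hb
  set d := pd 2 (pd 2 Θ) (c p) with hd
  refine ⟨v 0 • T 0 1 p + v 1 • T 1 1 p + (v 3 + v 0 * b - v 1 * d) • T 0 0 p
    + (v 0 * a - v 1 * b - v 2) • T 1 0 p, ?_⟩
  simp only [map_add, map_smul, h.frame _ _ p hp]
  ext i
  fin_cases i
  · simp [secondFrame]
  · simp [secondFrame]
  · simp [secondFrame, ← ha, ← hb]
    ring
  · simp [secondFrame, ← hb, ← hd]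

theorem differentiableOn_secondFrame (hN : IsOpen N) (hΘ : DifferentiableOn ℂ Θ N) (A A' : Fin 2) :
    DifferentiableOn ℂ (secondFrame Θ A A') N := by
  have h2 : ∀ i j, DifferentiableOn ℂ (pd i (pd j Θ)) N := fun i j =>
    differentiableOn_pd hN (differentiableOn_pd hN hΘ j) i
  fin_cases A <;> fin_cases A'
  · exact differentiableOn_const _
  · exact differentiableOn_vec (v := ![fun _ => 1, fun _ => 0, fun q => pd 3 (pd 3 Θ) q,
      fun q => -pd 2 (pd 3 Θ) q]) fun i => by
      fin_cases i
      · exact differentiableOn_const _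
      · exact differentiableOn_const _
      · exact h2 3 3
      · exact (h2 2 3).neg
  · exact differentiableOn_const _
  · exact differentiableOn_vec (v := ![fun _ => 0, fun _ => 1, fun q => -pd 2 (pd 3 Θ) q,
      fun q => pd 2 (pd 2 Θ) q]) fun i => by
      fin_cases i
      · exact differentiableOn_const _
      · exact differentiableOn_const _
      · exact (h2 2 3).neg
      · exact h2 2 2

/-- In the second Plebański form the wave equation is the linearised second heavenly equation. -/
theorem box_secondFrame (hN : IsOpen N) (hφ : DifferentiableOn ℂ φ N) {q : Pt}
    (hq : q ∈ N) : box (secondFrame Θ) φ q = -secondLinearised Θ φ q := by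
  have h00 : along (secondFrame Θ 0 0) φ = pd 3 φ := by
    ext x; rw [along_eq_sum]; simp [secondFrame]
  have h10 : along (secondFrame Θ 1 0) φ = fun x => -pd 2 φ x := by
    ext x; rw [along_eq_sum]; simp [secondFrame]
  rw [box_eq, h00, h10, along_neg, along_eq_sum, along_eq_sum,
    pd_comm hN hφ 0 2 hq, pd_comm hN hφ 1 3 hq, pd_comm hN hφ 3 2 hq]
  simp [secondFrame, secondLinearised]
  ring

theorem secondLinearised_eq_zero (hM : IsOpen M) (h : IsSecondForm M T c Θ) {ψ : Pt → ℂ}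
    (hψ : WaveSolution M T ψ) (hφψ : ∀ p ∈ M, φ (c p) = ψ p) :
    ∀ q ∈ c '' M, secondLinearised Θ φ q = 0 := by
  rintro _ ⟨p, hp, rfl⟩
  have hN := isOpen_image_of_surjective hM h.holomorphic h.surjective
  have hφ := differentiableOn_of_comp hM h.holomorphic h.surjective hψ.1 hφψ
  have hbox := box_comp hM hN (mapsTo_image c M) h.holomorphic
    (differentiableOn_secondFrame hN h.potential) h.frame hφ hφψ hp
  rwa [box_secondFrame hN hφ (mem_image_of_mem c hp), hψ.2 p hp, neg_eq_zero] at hbox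

end SecondForm

section FirstForm

variable {M N : Set Pt} {T : Frame} {c : Pt → Pt} {Ω φ : Pt → ℂ}

theorem IsFirstForm.surjective (h : IsFirstForm M T c Ω) :
    ∀ p ∈ M, Function.Surjective (fderiv ℂ c p) := by
  intro p hp v
  have hΩ := h.heavenly (c p) (mem_image_of_mem c hp)
  unfold firstHeavenly at hΩ
  set a := pd 0 (pd 3 Ω) (c p) with ha
  set b := pd 1 (pd 3 Ω) (c p) with hb
  set d := pd 0 (pd 2 Ω) (c p) with hd
  set e := pd 1 (pd 2 Ω) (c p) with he
  refine ⟨v 0 • T 0 1 p + v 1 • T 1 1 p - (v 2 * e + v 3 * b) • T 0 0 p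
    + (v 2 * d + v 3 * a) • T 1 0 p, ?_⟩
  simp only [map_add, map_sub, map_smul, h.frame _ _ p hp]
  ext i
  fin_cases i
  · simp [firstFrame]
  · simp [firstFrame]
  · simp [firstFrame, ← ha, ← hb]
    linear_combination v 2 * hΩ
  · simp [firstFrame, ← hd, ← he]
    linear_combination v 3 * hΩ

theorem differentiableOn_firstFrame (hN : IsOpen N) (hΩ : DifferentiableOn ℂ Ω N) (A A' : Fin 2) :
    DifferentiableOn ℂ (firstFrame Ω A A') N := by
  have h2 : ∀ i j, DifferentiableOn ℂ (pd i (pd j Ω)) N := fun i j =>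
    differentiableOn_pd hN (differentiableOn_pd hN hΩ j) i
  fin_cases A <;> fin_cases A'
  · exact differentiableOn_vec (v := ![fun _ => 0, fun _ => 0, fun q => -pd 0 (pd 3 Ω) q,
      fun q => pd 0 (pd 2 Ω) q]) fun i => by
      fin_cases i
      · exact differentiableOn_const _
      · exact differentiableOn_const _
      · exact (h2 0 3).neg
      · exact h2 0 2
  · exact differentiableOn_const _
  · exact differentiableOn_vec (v := ![fun _ => 0, fun _ => 0, fun q => -pd 1 (pd 3 Ω) q,
      fun q => pd 1 (pd 2 Ω) q]) fun i => by
      fin_cases i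
      · exact differentiableOn_const _
      · exact differentiableOn_const _
      · exact (h2 1 3).neg
      · exact h2 1 2
  · exact differentiableOn_const _

/-- In the first Plebański form the wave equation is the linearised first heavenly equation; the
third derivatives of the potential cancel. -/
theorem box_firstFrame (hN : IsOpen N) (hΩ : DifferentiableOn ℂ Ω N)
    (hφ : DifferentiableOn ℂ φ N) {q : Pt} (hq : q ∈ N) :
    box (firstFrame Ω) φ q = firstLinearised Ω φ q := by
  have h0 : ∀ A, along (firstFrame Ω A 0) φ = fun x =>
      -(pd (Fin.castLE (by norm_num) A) (pd 3 Ω) x * pd 2 φ x)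
        + pd (Fin.castLE (by norm_num) A) (pd 2 Ω) x * pd 3 φ x := by
    intro A
    ext x
    rw [along_eq_sum]
    fin_cases A <;> simp [firstFrame]
  have h01 : ∀ χ, along (firstFrame Ω 0 1) χ q = pd 0 χ q := by
    intro χ; rw [along_eq_sum]; simp [firstFrame]
  have h11 : ∀ χ, along (firstFrame Ω 1 1) χ q = pd 1 χ q := by
    intro χ; rw [along_eq_sum]; simp [firstFrame]
  have d1 : ∀ i, DifferentiableAt ℂ (pd i φ) q := fun i =>
    (differentiableOn_pd hN hφ i).differentiableAt (hN.mem_nhds hq)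
  have d2 : ∀ i j, DifferentiableAt ℂ (pd i (pd j Ω)) q := fun i j =>
    (differentiableOn_pd hN (differentiableOn_pd hN hΩ j) i).differentiableAt (hN.mem_nhds hq)
  have hexp : ∀ i k, pd k (fun x => -(pd i (pd 3 Ω) x * pd 2 φ x) + pd i (pd 2 Ω) x * pd 3 φ x) q
      = -(pd i (pd 3 Ω) q * pd k (pd 2 φ) q + pd k (pd i (pd 3 Ω)) q * pd 2 φ q)
        + (pd i (pd 2 Ω) q * pd k (pd 3 φ) q + pd k (pd i (pd 2 Ω)) q * pd 3 φ q) := by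
    intro i k
    rw [pd_add ((d2 i 3).fun_mul (d1 2)).fun_neg ((d2 i 2).fun_mul (d1 3)), pd_neg,
      pd_mul (d2 i 3) (d1 2), pd_mul (d2 i 2) (d1 3)]
  rw [box_eq, h01, h11, h0, h0]
  have c0 : (Fin.castLE (by norm_num) (0 : Fin 2) : Fin 4) = 0 := rfl
  have c1 : (Fin.castLE (by norm_num) (1 : Fin 2) : Fin 4) = 1 := rfl
  rw [c0, c1, hexp, hexp, pd_comm hN (differentiableOn_pd hN hΩ 3) 0 1 hq,
    pd_comm hN (differentiableOn_pd hN hΩ 2) 0 1 hq]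
  unfold firstLinearised
  ring

theorem firstLinearised_eq_zero (hM : IsOpen M) (h : IsFirstForm M T c Ω) {ψ : Pt → ℂ}
    (hψ : WaveSolution M T ψ) (hφψ : ∀ p ∈ M, φ (c p) = ψ p) :
    ∀ q ∈ c '' M, firstLinearised Ω φ q = 0 := by
  rintro _ ⟨p, hp, rfl⟩
  have hN := isOpen_image_of_surjective hM h.holomorphic h.surjective
  have hφ := differentiableOn_of_comp hM h.holomorphic h.surjective hψ.1 hφψ
  have hbox := box_comp hM hN (mapsTo_image c M) h.holomorphic
    (differentiableOn_firstFrame hN h.potential) h.frame hφ hφψ hp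
  rwa [box_firstFrame hN h.potential hφ (mem_image_of_mem c hp), hψ.2 p hp] at hbox

end FirstForm

/-! ### Variation of the twistor lines -/

section Sections

variable {M : Set Pt} {C : Set Spinor} {f g : Pt × Spinor → ℂ} {n m : ℕ}

theorem IsSection.mul (hf : IsSection M C n f) (hg : IsSection M C m g) :
    IsSection M C (n + m) (fun q => f q * g q) :=
  ⟨hf.1.mul hg.1, fun p hp π hπ t ht => by
    simp only
    rw [hf.2 p hp π hπ t ht, hg.2 p hp π hπ t ht]
    ring⟩

theorem IsSection.sub (hf : IsSection M C n f) (hg : IsSection M C n g) :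
    IsSection M C n (fun q => f q - g q) :=
  ⟨hf.1.sub hg.1, fun p hp π hπ t ht => by
    simp only
    rw [hf.2 p hp π hπ t ht, hg.2 p hp π hπ t ht]
    ring⟩

theorem IsSection.eq_affine_infinity (hf : IsSection M C n f) {p : Pt} (hp : p ∈ M) {π : Spinor}
    (h0 : π 0 ≠ 0) (h : ![1, π 1 / π 0] ∈ C) :
    f (p, π) = π 0 ^ n * f (p, ![1, π 1 / π 0]) := by
  rw [← hf.2 p hp _ h _ h0]
  congr
  ext i
  fin_cases i
  · simp
  · simp [mul_div_cancel₀ _ h0]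

/-- The symplectic pairing `u⁰ v¹ - u¹ v⁰`. -/
def wedge (u v : Fin 2 → ℂ) : ℂ := u 0 * v 1 - u 1 * v 0

/-- A matrix of determinant one preserves the symplectic form. -/
theorem wedge_of_det_eq_one {N : Fin 2 → Fin 2 → ℂ} (hN : (Matrix.of N).det = 1)
    {u v u' v' : Fin 2 → ℂ} (hu : ∀ A, u' A = ∑ B, N A B * u B)
    (hv : ∀ A, v' A = ∑ B, N A B * v B) : wedge u' v' = wedge u v := by
  rw [Matrix.det_fin_two] at hN
  simp only [Matrix.of_apply] at hN
  unfold wedge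
  rw [hu, hu, hv, hv]
  simp only [Fin.sum_univ_two]
  linear_combination (u 0 * v 1 - u 1 * v 0) * hN

end Sections

section Lines

variable {M : Set Pt} {T : Frame} {ε : ℝ} {c : Pt → Pt} {Θ : Pt → ℂ} {W : Set (Spinor × Spinor)}
  {P : Fin 2 → Spinor × Spinor → ℂ} {ω ω' : Fin 2 → Pt × Spinor → ℂ}

/-- The derivatives `V(ω^B)` of the twistor coordinates. -/
def alongC (V : VF) (ω : Fin 2 → Pt × Spinor → ℂ) (q : Pt × Spinor) : Fin 2 → ℂ :=
  fun B => alongS V (ω B) q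

/-- The chain rule for a function of the twistor coordinates. -/
theorem alongS_twistorPt (hM : IsOpen M) (hP : IsTwistorPatching M T ε c Θ W P ω ω')
    {G : Spinor × Spinor → ℂ} (hG : DifferentiableOn ℂ G W) {g : Pt × Spinor → ℂ} {π : Spinor}
    (hπ : π ∈ patchU ε ∩ patchU' ε) (hg : ∀ p ∈ M, g (p, π) = G (twistorPt ω p π)) (V : VF)
    {p : Pt} (hp : p ∈ M) :
    alongS V g (p, π) = ∑ B, pdOmega B G (twistorPt ω p π) * alongC V ω (p, π) B := by
  have hGp := (hG.differentiableAt (hP.isOpen.mem_nhds (hP.mem p hp π hπ))).hasFDerivAt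
  have hωp : ∀ B, HasFDerivAt (fun q => ω B (q, π)) (fderiv ℂ (fun q => ω B (q, π)) p) p :=
    fun B => ((differentiableOn_slice (hP.coord B).1.1 hπ.1).differentiableAt
      (hM.mem_nhds hp)).hasFDerivAt
  have hZ : HasFDerivAt (fun q => twistorPt ω q π)
      ((ContinuousLinearMap.pi fun B => fderiv ℂ (fun q => ω B (q, π)) p).prod 0) p :=
    (hasFDerivAt_pi.2 hωp).prodMk (hasFDerivAt_const π p)
  have hcomp := HasFDerivAt.comp p hGp hZ
  have h1 : alongS V g (p, π) = along V (G ∘ fun q => twistorPt ω q π) p :=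
    along_congr hM (fun q hq => hg q hq) hp
  rw [h1]
  unfold along
  rw [hcomp.fderiv]
  have hv : (((ContinuousLinearMap.pi fun B => fderiv ℂ (fun q => ω B (q, π)) p).prod
      (0 : Pt →L[ℂ] Spinor)) (V p)) = ∑ B, alongC V ω (p, π) B • ((Pi.single B 1, 0) :
      Spinor × Spinor) := by
    ext j
    · fin_cases j <;> simp [alongC, alongS, along]
    · simp
  rw [ContinuousLinearMap.comp_apply, hv, map_sum]
  refine Finset.sum_congr rfl fun B _ => ?_
  rw [map_smul, smul_eq_mul, mul_comm]
  rfl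

theorem alongC_transition (hM : IsOpen M) (hP : IsTwistorPatching M T ε c Θ W P ω ω')
    {π : Spinor} (hπ : π ∈ patchU ε ∩ patchU' ε) (V : VF) {p : Pt} (hp : p ∈ M) (A : Fin 2) :
    alongC V ω' (p, π) A = ∑ B, pdOmega B (P A) (twistorPt ω p π) * alongC V ω (p, π) B :=
  alongS_twistorPt hM hP (hP.transition_holomorphic A) hπ (fun q hq => hP.transition A q hq π hπ)
    V hp

theorem coord_zero (hP : IsTwistorPatching M T ε c Θ W P ω ω') {p : Pt} (hp : p ∈ M)
    (A : Fin 2) : ω A (p, ![0, 1]) = (![c p 0, c p 1] : Fin 2 → ℂ) A := by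
  obtain ⟨K, hK⟩ := (hP.jet A p hp).bound
  have h := hK.self_of_nhds
  rw [← sub_eq_zero]
  simpa using h

/-- At `λ = 0` the derivatives of the twistor coordinates along `∇_{A1'}` are the standard
basis. -/
theorem alongC_zero (hM : IsOpen M) (hc : IsSecondForm M T c Θ)
    (hP : IsTwistorPatching M T ε c Θ W P ω ω') {p : Pt} (hp : p ∈ M) (A : Fin 2) :
    alongC (T A 1) ω (p, ![0, 1]) = Pi.single A 1 := by
  have hcp := hc.holomorphic.differentiableAt (hM.mem_nhds hp)
  have hcoord : ∀ D i, along (T D 1) (fun q => c q i) p = secondFrame Θ D 1 (c p) i := by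
    intro D i
    rw [← hc.frame D 1 p hp]
    unfold along
    rw [fderiv_apply hcp]
    rfl
  have h : ∀ B, alongC (T A 1) ω (p, ![0, 1]) B
      = along (T A 1) (fun q => (![c q 0, c q 1] : Fin 2 → ℂ) B) p := fun B =>
    along_congr hM (fun q hq => coord_zero hP hq B) hp
  ext B
  rw [h]
  fin_cases A <;> fin_cases B <;> simp [hcoord, secondFrame]

theorem isSection_wedge (hM : IsOpen M) {C : Set Spinor} (hC : IsOpen C)
    (hT : IsASDVacuumTetrad M T) {n : ℕ} {u v : Fin 2 → Pt × Spinor → ℂ}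
    (hu : ∀ A, IsSection M C n (u A)) (hv : ∀ A, IsSection M C 1 (v A)) (A A' : Fin 2) :
    IsSection M C (n + 1) (fun q => wedge (fun B => u B q) (alongC (T A A') v q)) :=
  ((hu 0).mul ((hv 1).alongS hM hC (hT.holomorphic A A'))).sub
    ((hu 1).mul ((hv 0).alongS hM hC (hT.holomorphic A A')))

theorem alongC_twistor {C : Set Spinor} {v : Fin 2 → Pt × Spinor → ℂ}
    (hv : ∀ A, IsTwistorFunction M T C 1 (v A)) (A : Fin 2) {p : Pt} (hp : p ∈ M) {π : Spinor}
    (hπ : π ∈ C) (B : Fin 2) :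
    π 1 * alongC (T A 0) v (p, π) B = π 0 * alongC (T A 1) v (p, π) B :=
  (isTwistorFunction_iff.1 (hv B)).2 A p hp π hπ

/-- The symplectic form restricted to the twistor lines: by Liouville's theorem it is
`ε_{AB} π_{A'} π_{B'}`. -/
theorem wedge_alongC (hM : IsOpen M) (hT : IsASDVacuumTetrad M T) (hε₀ : 0 < ε) (hε : ε < 1)
    (hc : IsSecondForm M T c Θ) (hP : IsTwistorPatching M T ε c Θ W P ω ω') {p : Pt}
    (hp : p ∈ M) :
    (∀ π ∈ patchU ε, wedge (alongC (T 0 1) ω (p, π)) (alongC (T 1 1) ω (p, π)) = π 1 ^ 2) ∧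
      ∀ π ∈ patchU' ε,
        wedge (alongC (T 0 0) ω' (p, π)) (alongC (T 1 0) ω' (p, π)) = π 0 ^ 2 := by
  have hsec : IsSection M (patchU ε) 2 (fun q => wedge (alongC (T 0 1) ω q) (alongC (T 1 1) ω q)) :=
    isSection_wedge hM (isOpen_patchU ε) hT (u := fun B => alongS (T 0 1) (ω B))
      (fun B => (hP.coord B).1.alongS hM (isOpen_patchU ε) (hT.holomorphic 0 1))
      (fun B => (hP.coord B).1) 1 1
  have hsec' : IsSection M (patchU' ε) 2
      (fun q => wedge (alongC (T 0 0) ω' q) (alongC (T 1 0) ω' q)) :=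
    isSection_wedge hM (isOpen_patchU' ε) hT (u := fun B => alongS (T 0 0) (ω' B))
      (fun B => (hP.coord' B).1.alongS hM (isOpen_patchU' ε) (hT.holomorphic 0 0))
      (fun B => (hP.coord' B).1) 1 0
  have hg := differentiableOn_affine hsec.1 hp fun z hz => affine_mem_patchU.2 hz
  have he := differentiableOn_infinity hsec'.1 hp fun z hz => (infinity_mem_patchU' hε).2 hz
  have h1ε : 0 < 1 - ε := by linarith
  have hglue : ∀ z ∈ annulus ((1 - ε)⁻¹)⁻¹ (1 + ε),
      wedge (alongC (T 0 1) ω (p, ![z, 1])) (alongC (T 1 1) ω (p, ![z, 1]))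
        = wedge (alongC (T 0 0) ω' (p, ![1, z⁻¹])) (alongC (T 1 0) ω' (p, ![1, z⁻¹])) := by
    intro z hz
    rw [inv_inv] at hz
    have hmem := affine_mem_overlap.2 hz
    have hz0 : z ≠ 0 := norm_pos_iff.1 (h1ε.trans hz.1)
    have hinf : ![1, z⁻¹] ∈ patchU' ε := by
      rw [infinity_mem_patchU' hε, mem_ball_zero_iff, norm_inv]
      exact (inv_lt_inv₀ (norm_pos_iff.2 hz0) h1ε).2 hz.1
    have h1 := hsec'.eq_infinity hp hz0 hinf
    have h2 : ∀ A B, alongC (T A 0) ω' (p, ![z, 1]) B = z * alongC (T A 1) ω' (p, ![z, 1]) B :=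
      fun A B => by simpa using alongC_twistor hP.coord' A hp hmem.2 B
    have h3 := wedge_of_det_eq_one (hP.symplectic _ (hP.mem p hp _ hmem))
      (alongC_transition hM hP hmem (T 0 1) hp) (alongC_transition hM hP hmem (T 1 1) hp)
    rw [← h3]
    refine mul_left_cancel₀ (pow_ne_zero 2 hz0) (Eq.trans ?_ h1)
    simp only [wedge, h2]
    ring
  obtain ⟨hc1, hc2⟩ := eq_const_of_glue (by linarith) ((one_lt_inv₀ h1ε).2 (by linarith))
    hg he hglue
  have h0 : wedge (alongC (T 0 1) ω (p, ![0, 1])) (alongC (T 1 1) ω (p, ![0, 1])) = 1 := by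
    rw [alongC_zero hM hc hP hp, alongC_zero hM hc hP hp]
    simp [wedge]
  constructor
  · intro π hπ
    have hπ1 := ne_zero_of_mem_patchU hπ
    have hmem : π 0 / π 1 ∈ ball (0 : ℂ) (1 + ε) := by
      rw [mem_ball_zero_iff, norm_div, div_lt_iff₀ (norm_pos_iff.2 hπ1)]
      exact hπ
    refine (hsec.eq_affine hp hπ1 (affine_mem_patchU.2 hmem)).trans ?_
    rw [hc1 _ hmem, h0, mul_one]
  · intro π hπ
    have hπ0 := ne_zero_of_mem_patchU' hε hπ
    have hmem : π 1 / π 0 ∈ ball (0 : ℂ) (1 - ε)⁻¹ := by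
      rw [mem_ball_zero_iff, norm_div, ← one_div, lt_div_iff₀ h1ε, div_mul_eq_mul_div,
        div_lt_one (norm_pos_iff.2 hπ0), mul_comm]
      exact hπ
    refine (hsec'.eq_affine_infinity hp hπ0 ((infinity_mem_patchU' hε).2 hmem)).trans ?_
    rw [hc2 _ hmem, h0, mul_one]

variable {f : Pt × Spinor → ℂ} {F : Spinor × Spinor → ℂ}

/-- `V(δf)` is the symplectic pairing of the Hamiltonian vector field with `V(ω)`. -/
theorem alongS_hamiltonian (hM : IsOpen M) (hP : IsTwistorPatching M T ε c Θ W P ω ω')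
    (hF : DifferentiableOn ℂ F W)
    (hfF : ∀ p ∈ M, ∀ π ∈ patchU ε ∩ patchU' ε, f (p, π) = F (twistorPt ω p π)) (V : VF)
    {p : Pt} (hp : p ∈ M) {π : Spinor} (hπ : π ∈ patchU ε ∩ patchU' ε) :
    alongS V f (p, π) = wedge (hamVF F (twistorPt ω p π)) (alongC V ω (p, π)) := by
  rw [alongS_twistorPt hM hP hF hπ (fun q hq => hfF q hq π hπ) V hp]
  simp [wedge, hamVF, Fin.sum_univ_two]
  ring

/-- The second order coefficients of every variation of the twistor lines are given by the
Laurent coefficients of the derivatives of the Hamiltonian. -/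
theorem jet_of_isLineVariation (hM : IsOpen M) (hT : IsASDVacuumTetrad M T) (hε₀ : 0 < ε)
    (hε : ε < 1) {r : ℝ} (hr : r ∈ Ioo (1 - ε) (1 + ε)) (hc : IsSecondForm M T c Θ)
    (hf : IsTwistorFunction M T (patchU ε ∩ patchU' ε) 2 f)
    (hP : IsTwistorPatching M T ε c Θ W P ω ω') (hF : DifferentiableOn ℂ F W)
    (hfF : ∀ p ∈ M, ∀ π ∈ patchU ε ∩ patchU' ε, f (p, π) = F (twistorPt ω p π))
    {dω dω' : Fin 2 → Pt × Spinor → ℂ} (hd : IsLineVariation M ε P ω F dω dω')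
    {p : Pt} (hp : p ∈ M) (A : Fin 2) :
    (fun l : ℂ => dω A (p, ![l, 1])
      - l ^ 2 * (![-along (T 1 1) (moment r (fun z => (z ^ 3)⁻¹) f) p,
        along (T 0 1) (moment r (fun z => (z ^ 3)⁻¹) f) p] : Fin 2 → ℂ) A)
      =O[𝓝 0] fun l : ℂ => l ^ 3 := by
  have hr0 : 0 < r := by linarith [hr.1]
  have hR : (0 : ℝ) < 1 + ε := by linarith
  have hdiv : ∀ B, ∃ k : ℂ → ℂ, DifferentiableOn ℂ k (ball 0 (1 + ε)) ∧
      ∀ z, dω B (p, ![z, 1]) = z ^ 2 * k z := fun B =>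
    exists_eq_pow_mul_of_isBigO hR 2 (differentiableOn_affine (hd.section_U B).1 hp
      fun z hz => affine_mem_patchU.2 hz) (hd.gauge B p hp)
  choose k hk hdk using hdiv
  have hTω : ∀ B D, DifferentiableOn ℂ (fun z : ℂ => alongC (T D 1) ω (p, ![z, 1]) B)
      (ball 0 (1 + ε)) := fun B D =>
    differentiableOn_affine (differentiableOn_alongS hM (isOpen_patchU ε) (hT.holomorphic D 1)
      (hP.coord B).1.1) hp fun z hz => affine_mem_patchU.2 hz
  -- Compare the coefficients of `λ³` in the pairing `⟨δω̃, ∇_{D0'} ω̃⟩` and its expression through `δω`.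
  have hcoef : ∀ D, k 0 0 * alongC (T D 1) ω (p, ![0, 1]) 1
      - k 1 0 * alongC (T D 1) ω (p, ![0, 1]) 0
      + along (T D 1) (moment r (fun z => (z ^ 3)⁻¹) f) p = 0 := by
    intro D
    have hsec' := isSection_wedge hM (isOpen_patchU' ε) hT hd.section_U'
      (fun B => (hP.coord' B).1) D 0
    have h0 := moment_eq_zero_of_patchU' hε hr hsec' hp
    have hk' : DifferentiableOn ℂ (fun z => k 0 z * alongC (T D 1) ω (p, ![z, 1]) 1
        - k 1 z * alongC (T D 1) ω (p, ![z, 1]) 0) (ball 0 (1 + ε)) :=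
      ((hk 0).mul (hTω 1 D)).sub ((hk 1).mul (hTω 0 D))
    have hdf : ContinuousOn (fun z => alongS (T D 1) f (p, ![z, 1]) * (z ^ 3)⁻¹) (sphere 0 r) :=
      (differentiableOn_affine (differentiableOn_alongS hM (isOpen_overlap ε)
        (hT.holomorphic D 1) hf.1.1) hp
        fun z hz => affine_mem_overlap_of_sphere hr hz).continuousOn.mul
        (continuousOn_inv_pow hr0 3)
    have hk'' : ContinuousOn (fun z => (k 0 z * alongC (T D 1) ω (p, ![z, 1]) 1
        - k 1 z * alongC (T D 1) ω (p, ![z, 1]) 0) / z) (sphere 0 r) :=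
      (hk'.continuousOn.mono (sphere_subset_closedBall.trans (closedBall_subset_ball hr.2))).div
        continuousOn_id fun z hz => ne_of_mem_sphere hz hr0.ne'
    have hint : (∮ z in C(0, r), wedge (fun B => dω' B (p, ![z, 1]))
          (alongC (T D 0) ω' (p, ![z, 1])) * (z ^ (1 + 1 + 2))⁻¹)
        = (∮ z in C(0, r), (k 0 z * alongC (T D 1) ω (p, ![z, 1]) 1
            - k 1 z * alongC (T D 1) ω (p, ![z, 1]) 0) / z)
          + ∮ z in C(0, r), alongS (T D 1) f (p, ![z, 1]) * (z ^ 3)⁻¹ := by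
      rw [← circleIntegral.integral_add (hk''.circleIntegrable hr0.le)
        (hdf.circleIntegrable hr0.le)]
      refine circleIntegral.integral_congr hr0.le fun z hz => ?_
      have hmem := affine_mem_overlap_of_sphere hr hz
      have hz0 : z ≠ 0 := ne_of_mem_sphere hz hr0.ne'
      have h2 : ∀ B, alongC (T D 0) ω' (p, ![z, 1]) B = z * alongC (T D 1) ω' (p, ![z, 1]) B :=
        fun B => by simpa using alongC_twistor hP.coord' D hp hmem.2 B
      have h3 := wedge_of_det_eq_one (hP.symplectic _ (hP.mem p hp _ hmem))
        (fun B => hd.overlap B p hp _ hmem) (alongC_transition hM hP hmem (T D 1) hp)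
      have h4 : wedge (fun B => dω' B (p, ![z, 1])) (alongC (T D 0) ω' (p, ![z, 1]))
          = z * wedge (fun B => dω' B (p, ![z, 1])) (alongC (T D 1) ω' (p, ![z, 1])) := by
        simp only [wedge, h2]; ring
      rw [h4, h3, alongS_hamiltonian hM hP hF hfF (T D 1) hp hmem]
      simp only [wedge, hdk]
      field_simp
      ring
    rw [along_moment hM hε hr hf.1.1 3 _ hp]
    unfold moment at h0 ⊢
    rw [hint, circleIntegral_div_self hr0 hr.2 hk', mul_add, inv_mul_cancel_left₀
      (by simp [Real.pi_ne_zero])] at h0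
    exact h0
  have hk0 : k A 0 = (![-along (T 1 1) (moment r (fun z => (z ^ 3)⁻¹) f) p,
        along (T 0 1) (moment r (fun z => (z ^ 3)⁻¹) f) p] : Fin 2 → ℂ) A := by
    have e0 := hcoef 0
    have e1 := hcoef 1
    rw [alongC_zero hM hc hP hp] at e0 e1
    simp at e0 e1
    fin_cases A
    · simp; linear_combination e1
    · simp; linear_combination -e0
  rw [← hk0]
  have hO : (fun l : ℂ => k A l - k A 0) =O[𝓝 0] fun l : ℂ => l := by
    simpa using ((hk A).differentiableAt (ball_mem_nhds 0 hR)).isBigO_sub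
  refine (((isBigO_refl (fun l : ℂ => l ^ 2) (𝓝 0)).mul hO).congr (fun l => ?_) fun l => ?_)
  · rw [hdk]; ring
  · ring

/-- The linearised deformation can be integrated to first order on every twistor line: split the
derivatives `∇_{A0'} δf` over the overlap and solve for the variation with the symplectic form. -/
theorem exists_isLineVariation (hM : IsOpen M) (hT : IsASDVacuumTetrad M T) (hε₀ : 0 < ε)
    (hε : ε < 1) (hc : IsSecondForm M T c Θ)
    (hf : IsTwistorFunction M T (patchU ε ∩ patchU' ε) 2 f)
    (hP : IsTwistorPatching M T ε c Θ W P ω ω') (hF : DifferentiableOn ℂ F W)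
    (hfF : ∀ p ∈ M, ∀ π ∈ patchU ε ∩ patchU' ε, f (p, π) = F (twistorPt ω p π)) :
    ∃ dω dω' : Fin 2 → Pt × Spinor → ℂ, IsLineVariation M ε P ω F dω dω' := by
  have hspl : ∀ A, ∃ b a' : Pt × Spinor → ℂ, DifferentiableOn ℂ b (M ×ˢ patchU ε) ∧
      (∀ p ∈ M, ∀ π ∈ patchU ε, ∀ t : ℂ, t ≠ 0 → b (p, t • π) = t⁻¹ * b (p, π)) ∧
      IsSection M (patchU' ε) 2 a' ∧
      ∀ p ∈ M, ∀ π ∈ patchU ε ∩ patchU' ε,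
        alongS (T A 0) f (p, π) = π 0 ^ 3 * b (p, π) - a' (p, π) := fun A => by
    obtain ⟨b, a', h1, h2, h3, h4, -⟩ := exists_splitting hM hε₀ hε
      (hf.1.alongS hM (isOpen_overlap ε) (hT.holomorphic A 0))
    exact ⟨b, a', h1, h2, h3, h4⟩
  choose b a' hb hbh ha' hsplit using hspl
  have hTω : ∀ A B, IsSection M (patchU ε) 1 (alongS (T A 1) (ω B)) := fun A B =>
    (hP.coord B).1.alongS hM (isOpen_patchU ε) (hT.holomorphic A 1)
  have hTω' : ∀ A B, IsSection M (patchU' ε) 1 (alongS (T A 0) (ω' B)) := fun A B =>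
    (hP.coord' B).1.alongS hM (isOpen_patchU' ε) (hT.holomorphic A 0)
  -- The witnesses below solve `⟨δω, ∇_{A1'} ω⟩ = -π_{1'} π_{0'}² b_A` and
  -- `⟨δω̃, ∇_{A0'} ω̃⟩ = -a'_A` by Cramer's rule, the determinants being `π_{1'}²` and `π_{0'}²`.
  have hsU : ∀ B, IsSection M (patchU ε) 1 (fun q => q.2 0 ^ 2 * (q.2 1)⁻¹ *
      (b 0 q * alongS (T 1 1) (ω B) q - b 1 q * alongS (T 0 1) (ω B) q)) := by
    intro B
    constructor
    · have h0 : DifferentiableOn ℂ (fun q : Pt × Spinor => q.2 0 ^ 2 * (q.2 1)⁻¹)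
          (M ×ˢ patchU ε) :=
        DifferentiableOn.fun_mul (a := fun q : Pt × Spinor => q.2 0 ^ 2)
          (b := fun q : Pt × Spinor => (q.2 1)⁻¹) (by fun_prop)
          (DifferentiableOn.fun_inv (by fun_prop) fun q hq => ne_zero_of_mem_patchU hq.2)
      exact h0.mul (((hb 0).mul (hTω 1 B).1).sub ((hb 1).mul (hTω 0 B).1))
    · intro p hp π hπ t ht
      simp only [Pi.smul_apply, smul_eq_mul]
      rw [hbh 0 p hp π hπ t ht, hbh 1 p hp π hπ t ht, (hTω 1 B).2 p hp π hπ t ht,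
        (hTω 0 B).2 p hp π hπ t ht]
      have := ne_zero_of_mem_patchU hπ
      field_simp
  have hsU' : ∀ B, IsSection M (patchU' ε) 1 (fun q => (q.2 0 ^ 2)⁻¹ *
      (a' 0 q * alongS (T 1 0) (ω' B) q - a' 1 q * alongS (T 0 0) (ω' B) q)) := by
    intro B
    have hsec := ((ha' 0).mul (hTω' 1 B)).sub ((ha' 1).mul (hTω' 0 B))
    constructor
    · have h0 : DifferentiableOn ℂ (fun q : Pt × Spinor => (q.2 0 ^ 2)⁻¹) (M ×ˢ patchU' ε) :=
        DifferentiableOn.fun_inv (by fun_prop)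
          fun q hq => pow_ne_zero 2 (ne_zero_of_mem_patchU' hε hq.2)
      exact h0.mul hsec.1
    · intro p hp π hπ t ht
      have h := hsec.2 p hp π hπ t ht
      simp only [Pi.smul_apply, smul_eq_mul] at h ⊢
      rw [h]
      have := ne_zero_of_mem_patchU' hε hπ
      field_simp
  refine ⟨_, _, hsU, hsU', fun A p hp π hπ => ?_, fun A p hp => ?_⟩
  · have hπ1 := ne_zero_of_mem_patchU hπ.1
    have hπ0 := ne_zero_of_mem_patchU' hε hπ.2
    have htw := fun A B => alongC_twistor hP.coord A hp hπ.1 B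
    have htw' : ∀ A B, alongC (T A 0) ω (p, π) B = π 0 / π 1 * alongC (T A 1) ω (p, π) B :=
      fun A B => by
        have := htw A B
        field_simp
        linear_combination this
    have hω' : ∀ D, alongS (T D 0) (ω' A) (p, π) = _ := fun D =>
      alongC_transition hM hP hπ (T D 0) hp A
    have hD := (wedge_alongC hM hT hε₀ hε hc hP hp).1 π hπ.1
    have ha : ∀ D, a' D (p, π) = π 0 ^ 3 * b D (p, π)
        - wedge (hamVF F (twistorPt ω p π)) (alongC (T D 0) ω (p, π)) := fun D => by
      rw [← alongS_hamiltonian hM hP hF hfF _ hp hπ, hsplit D p hp π hπ]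
      ring
    simp only [hω', ha, Fin.sum_univ_two, wedge, htw'] at hD ⊢
    change _ = _ * (_ * (_ * alongC (T 1 1) ω (p, π) 0 - _ * alongC (T 0 1) ω (p, π) 0) + _)
      + _ * (_ * (_ * alongC (T 1 1) ω (p, π) 1 - _ * alongC (T 0 1) ω (p, π) 1) + _)
    generalize alongC (T 0 1) ω (p, π) 0 = x00 at *
    generalize alongC (T 0 1) ω (p, π) 1 = x01 at *
    generalize alongC (T 1 1) ω (p, π) 0 = x10 at *
    generalize alongC (T 1 1) ω (p, π) 1 = x11 at *
    generalize hamVF F (twistorPt ω p π) 0 = y0 at *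
    generalize hamVF F (twistorPt ω p π) 1 = y1 at *
    generalize pdOmega 0 (P A) (twistorPt ω p π) = n0 at *
    generalize pdOmega 1 (P A) (twistorPt ω p π) = n1 at *
    generalize b 0 (p, π) = b0 at *
    generalize b 1 (p, π) = b1 at *
    field_simp
    linear_combination (n0 * y0 + n1 * y1) * hD
  · have hcont : ContinuousAt (fun l : ℂ => b 0 (p, ![l, 1]) * alongS (T 1 1) (ω A) (p, ![l, 1])
        - b 1 (p, ![l, 1]) * alongS (T 0 1) (ω A) (p, ![l, 1])) 0 :=
      ((differentiableOn_affine (((hb 0).mul (hTω 1 A).1).sub ((hb 1).mul (hTω 0 A).1)) hp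
        fun z hz => affine_mem_patchU.2 hz).differentiableAt
        (ball_mem_nhds (0 : ℂ) (by linarith : (0 : ℝ) < 1 + ε))).continuousAt
    have h := (isBigO_refl (fun l : ℂ => l ^ 2) (𝓝 0)).mul (hcont.isBigO_one ℂ)
    simpa using h

end Lines

end Heavenly

end

theorem mainTheorem2 (M : Set Heavenly.Pt) (hM : IsOpen M) (T : Heavenly.Frame)
    (hT : Heavenly.IsASDVacuumTetrad M T) (ε : ℝ) (hε₀ : 0 < ε) (hε₁ : ε < 1)
    (r : ℝ) (hr : r ∈ Set.Ioo (1 - ε) (1 + ε))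
    (f : Heavenly.Pt × Heavenly.Spinor → ℂ)
    (hf : Heavenly.IsTwistorFunction M T (Heavenly.patchU ε ∩ Heavenly.patchU' ε) 2 f) :
    -- the contour integral does not depend on the circle and gives a solution of the wave equation
    (∀ s ∈ Set.Ioo (1 - ε) (1 + ε), ∀ p ∈ M,
      Heavenly.deltaTheta s f p = Heavenly.deltaTheta r f p ∧
      Heavenly.deltaOmega s f p = Heavenly.deltaOmega r f p) ∧
    Heavenly.WaveSolution M T (Heavenly.deltaTheta r f) ∧
    -- `R δf = λ⁻¹ δf`
    Heavenly.IsTwistorFunction M T (Heavenly.patchU ε ∩ Heavenly.patchU' ε) 2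
      (Heavenly.lambdaInv f) ∧
    Heavenly.IsRecursion M T (Heavenly.deltaTheta r f)
      (Heavenly.deltaTheta r (Heavenly.lambdaInv f)) ∧
    -- the twistor functions of `R δΘ` are `λ⁻¹ δf`, up to the cohomological freedom
    (∀ f' : Heavenly.Pt × Heavenly.Spinor → ℂ,
      Heavenly.IsTwistorFunction M T (Heavenly.patchU ε ∩ Heavenly.patchU' ε) 2 f' →
      (Heavenly.IsRecursion M T (Heavenly.deltaTheta r f) (Heavenly.deltaTheta r f') ↔
        Heavenly.Cohomologous M T ε f' (Heavenly.lambdaInv f))) ∧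
    -- in second Plebański form
    (∀ (c : Heavenly.Pt → Heavenly.Pt) (Θ : Heavenly.Pt → ℂ), Heavenly.IsSecondForm M T c Θ →
      ∀ φ : Heavenly.Pt → ℂ, (∀ p ∈ M, φ (c p) = Heavenly.deltaTheta r f p) →
        -- `δΘ` solves the linearised second heavenly equation
        (∀ q ∈ c '' M, Heavenly.secondLinearised Θ φ q = 0) ∧
        -- `δΘ` is the variation of `Θ` under the linearised deformation with Hamiltonian `δf`
        ∀ (W : Set (Heavenly.Spinor × Heavenly.Spinor))
          (P : Fin 2 → Heavenly.Spinor × Heavenly.Spinor → ℂ)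
          (ω ω' : Fin 2 → Heavenly.Pt × Heavenly.Spinor → ℂ)
          (F : Heavenly.Spinor × Heavenly.Spinor → ℂ),
          Heavenly.IsTwistorPatching M T ε c Θ W P ω ω' → DifferentiableOn ℂ F W →
          (∀ p ∈ M, ∀ π ∈ Heavenly.patchU ε ∩ Heavenly.patchU' ε,
            f (p, π) = F (Heavenly.twistorPt ω p π)) →
          (∃ dω dω' : Fin 2 → Heavenly.Pt × Heavenly.Spinor → ℂ,
            Heavenly.IsLineVariation M ε P ω F dω dω') ∧
          ∀ dω dω' : Fin 2 → Heavenly.Pt × Heavenly.Spinor → ℂ,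
            Heavenly.IsLineVariation M ε P ω F dω dω' → ∀ A, ∀ p ∈ M,
              (fun l : ℂ => dω A (p, ![l, 1]) - l ^ 2 * Heavenly.jetTwo φ (c p) A)
                =O[𝓝 0] fun l : ℂ => l ^ 3) ∧
    -- the formula for `δΩ`: `R² δΩ = δΘ`
    (∃ ψ : Heavenly.Pt → ℂ, Heavenly.IsRecursion M T (Heavenly.deltaOmega r f) ψ ∧
      Heavenly.IsRecursion M T ψ (Heavenly.deltaTheta r f)) ∧
    -- in first Plebański form, `δΩ` solves the linearised first heavenly equation
    (∀ (c : Heavenly.Pt → Heavenly.Pt) (Ω : Heavenly.Pt → ℂ), Heavenly.IsFirstForm M T c Ω →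
      ∀ φ : Heavenly.Pt → ℂ, (∀ p ∈ M, φ (c p) = Heavenly.deltaOmega r f p) →
        ∀ q ∈ c '' M, Heavenly.firstLinearised Ω φ q = 0) := by
  have hr0 : 0 < r := by linarith [hr.1]
  have hΘ : Heavenly.deltaTheta r f = fun q => -Heavenly.moment r (fun z => (z ^ 4)⁻¹) f q :=
    funext (Heavenly.deltaTheta_eq r f)
  have hΩ : Heavenly.deltaOmega r f = fun q => -Heavenly.moment r (fun z => (z ^ 2)⁻¹) f q :=
    funext (Heavenly.deltaOmega_eq r f)
  have hΘi : Heavenly.deltaTheta r (Heavenly.lambdaInv f)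
      = fun q => -Heavenly.moment r (fun z => (z ^ 5)⁻¹) f q := by
    funext q
    rw [Heavenly.deltaTheta_eq, Heavenly.moment_lambdaInv hr0]
  have hlam := Heavenly.isTwistorFunction_lambdaInv hM hε₁ hf
  have hwave : Heavenly.WaveSolution M T (Heavenly.deltaTheta r f) := by
    rw [hΘ]; exact Heavenly.waveSolution_moment hM hT hε₁ hr hf 3
  have hwaveΩ : Heavenly.WaveSolution M T (Heavenly.deltaOmega r f) := by
    rw [hΩ]; exact Heavenly.waveSolution_moment hM hT hε₁ hr hf 1
  have hrec : Heavenly.IsRecursion M T (Heavenly.deltaTheta r f)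
      (Heavenly.deltaTheta r (Heavenly.lambdaInv f)) := by
    rw [hΘ, hΘi]; exact Heavenly.isRecursion_moment hM hT hε₁ hr hf 3
  refine ⟨fun s hs p hp => ?_, hwave, hlam, hrec, fun f' hf' => ?_, fun c Θ hc φ hφ => ?_, ?_,
    fun c Ω hc φ hφ => Heavenly.firstLinearised_eq_zero hM hc hwaveΩ hφ⟩
  · simp only [Heavenly.deltaTheta_eq, Heavenly.deltaOmega_eq]
    constructor <;> rw [Heavenly.moment_eq_of_annulus hε₁
      (Heavenly.differentiableOn_inv_pow (by linarith) _ _) hf.1.1 hp hs hr]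
  · rw [Heavenly.cohomologous_iff hM hT hε₀ hε₁ hr hf' hlam]
    have hwave' : Heavenly.WaveSolution M T (Heavenly.deltaTheta r f') := by
      rw [funext (Heavenly.deltaTheta_eq r f')]
      exact Heavenly.waveSolution_moment hM hT hε₁ hr hf' 3
    have hrec' := (Heavenly.isRecursion_iff.1 hrec).2.2
    rw [Heavenly.isRecursion_iff]
    -- Both `δΘ[f']` and `δΘ[λ⁻¹ δf]` are compared through their derivatives along `∇_{A0'}`.
    constructor
    · rintro ⟨-, -, h⟩ A p hp
      have h1 := (h A p hp).symm.trans (hrec' A p hp)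
      rw [funext (Heavenly.deltaTheta_eq r f'),
        funext (Heavenly.deltaTheta_eq r (Heavenly.lambdaInv f)), Heavenly.along_neg,
        Heavenly.along_neg] at h1
      exact neg_injective h1
    · intro h
      refine ⟨hwave, hwave', fun A p hp => (hrec' A p hp).trans ?_⟩
      rw [funext (Heavenly.deltaTheta_eq r f'),
        funext (Heavenly.deltaTheta_eq r (Heavenly.lambdaInv f)), Heavenly.along_neg,
        Heavenly.along_neg, h A p hp]
  · refine ⟨Heavenly.secondLinearised_eq_zero hM hc hwave hφ, fun W P ω ω' F hP hF hfF =>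
      ⟨Heavenly.exists_isLineVariation hM hT hε₀ hε₁ hc hf hP hF hfF,
        fun dω dω' hd A p hp => ?_⟩⟩
    have hjet := Heavenly.jet_of_isLineVariation hM hT hε₀ hε₁ hr hc hf hP hF hfF hd hp A
    have hN := Heavenly.isOpen_image_of_surjective hM hc.holomorphic hc.surjective
    have hφd := Heavenly.differentiableOn_of_comp hM hc.holomorphic hc.surjective hwave.1 hφ
    have hal : ∀ B, Heavenly.along (Heavenly.secondFrame Θ B 0) φ (c p)
        = -Heavenly.along (T B 1) (Heavenly.moment r (fun z => (z ^ 3)⁻¹) f) p := fun B => by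
      rw [Heavenly.along_comp hM hN (Set.mapsTo_image c M) hc.holomorphic hφd hφ hp
        (hc.frame B 0 p hp), hΘ, Heavenly.along_neg,
        Heavenly.along_moment_succ hM hε₁ hr hf 3 B hp]
    have hjetTwo : Heavenly.jetTwo φ (c p)
        = ![-Heavenly.along (T 1 1) (Heavenly.moment r (fun z => (z ^ 3)⁻¹) f) p,
          Heavenly.along (T 0 1) (Heavenly.moment r (fun z => (z ^ 3)⁻¹) f) p] := by
      have h0 := hal 0
      have h1 := hal 1
      rw [Heavenly.along_eq_sum] at h0 h1
      simp only [Heavenly.secondFrame] at h0 h1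
      simp at h0 h1
      rw [Heavenly.jetTwo, h0, h1, neg_neg]
    rw [hjetTwo]
    exact hjet
  · refine ⟨fun q => -Heavenly.moment r (fun z => (z ^ 3)⁻¹) f q, ?_, ?_⟩
    · rw [hΩ]; exact Heavenly.isRecursion_moment hM hT hε₁ hr hf 1
    · rw [hΘ]; exact Heavenly.isRecursion_moment hM hT hε₁ hr hf 2
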